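/- Throughout, matroids may be infinite: a matroid on a set $E$ is a pair $(E,\mathcal I)$ with $\mathcal I\subseteq\mathcal P(E)$ (the independent sets) such that (1) $\varnothing\in\mathcal I$; (2) $\mathcal I$ is closed under taking subsets; (3) if $I,J\in\mathcal I$, where $J$ is $\subseteq$-maximal in $\mathcal I$ and $I$ is not, then $I\cup\{e\}\in\mathcal I$ for some $e\in J\setminus I$; (4) for every $X\subseteq E$, every $I\in\mathcal I$ with $I\subseteq X$ extends to a $\subseteq$-maximal element of $\mathcal I\cap\mathcal P(X)$. The circuits are the minimal non-independent subsets of $E$, the bases are the maximal independent sets, and the dual $M^*$ is the matroid on $E$ whose bases are the complements of the bases of $M$. A set $X\subseteq E$ spans $e\in E$ in $M$ if $e\in X$ or there is a circuit $C\ni e$ with $C\setminus\{e\}\subseteq X$; it spans $Y\subseteq E$ if it spans every element of $Y$. A matroid is finitary if all its circuits are finite, and cofinitary if its dual is finitary. The direct sum of matroids on disjoint sets $E_0$ and $E_1$ is the matroid on $E_0\sqcup E_1$ whose independent sets are the sets $I_0\cup I_1$ with $I_i$ independent in the $i$-th matroid; $E_0$ or $E_1$ may be empty. **Theorem 1.2.**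 Let $M$ and $N$ be matroids on the same countable edge set $E$, each of which is the direct sum of a finitary matroid and a cofinitary matroid. Then there are a set $I\subseteq E$ that is independent in both $M$ and $N$ and a partition $E=E_M\sqcup E_N$ (parts may be empty) such that $I\cap E_M$ spans $E_M$ in $M$ and $I\cap E_N$ spans $E_N$ in $N$. -/

import Mathlib

namespace Matroid

/-- A matroid is cofinitary if its dual is finitary, i.e. if all its cocircuits are finite. -/
def IsCofinitary {α : Type*} (M : Matroid α) : Prop :=
  M✶.Finitary

/-- The class `𝔉 ⊕ 𝔉*`: `M` is the direct sum of a finitary matroid `F` and a cofinitary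
matroid `C` on disjoint ground sets (either of which may be empty). -/
def IsFinitarySumCofinitary {α : Type*} (M : Matroid α) : Prop :=
  ∃ (F C : Matroid α) (h : Disjoint F.E C.E),
    F.Finitary ∧ C.IsCofinitary ∧ M = F.disjointSum C h

end Matroid

/-! The case of two finitary matroids carries the combinatorics; duality reduces the general case to
it. Reduction: let `N = F ⊕ C` with `C✶` finitary. Add a second copy of the ground set of `C`,
replace `M` by `M ⊕ C✶`, and replace `N` by the finitary matroid keeping `F` and making the two
copies of each element of `C` parallel. A common independent set then consists of disjoint sets `I`
and `K`, with `I` independent in `M` and `K` in `C✶`. Orthogonality of circuits and cocircuits turns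
an intersection for the new pair into one for the old pair (`hasIntersection_of_sum_doubleFree`).
Applied to each side in turn, this makes both matroids finitary. Finitary case: the union of all
waves is a wave `W` (`isWave_maxWave`), which settles one side of the partition. After contracting
`W` in `M` and deleting it from `N` no nonempty wave remains, and it suffices to find an
`M`-independent set spanning `N` (`exists_indep_spanning`). It is the union of a chain of nice sets,
each spanning one more element of a countable enumeration. A nice set stays nice after an
augmentation followed by contracting a maximal wave (`IsNice.exists_nice_superset`). If augmenting
in order of priority left some elements unspanned forever, the elements reachable from them by
alternating paths would form a wave in the limit. By niceness this wave consists of `M`-loops and is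
spanned in `N` by its complement, so finitarity puts every element into the span at a finite stage
(`exists_nice_mem_closure`). -/

namespace Matroid

/-! ### Independence modulo a set, and waves -/

section

variable {α : Type*} {M N : Matroid α} {X Y Z B B' I J W : Set α}

/-- `B` is independent in the contraction `N ／ X`, expressed by closures in `N`. -/
def IndepMod (N : Matroid α) (X B : Set α) : Prop :=
  B ⊆ N.E ∧ ∀ b ∈ B, b ∉ N.closure (X ∪ B \ {b})

lemma indepMod_empty_iff : N.IndepMod ∅ B ↔ N.Indep B := by
  rw [indep_iff_forall_notMem_closure_sdiff', IndepMod]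
  simp

lemma IndepMod.subset (h : N.IndepMod X B) (hB : B' ⊆ B) : N.IndepMod X B' :=
  ⟨hB.trans h.1, fun b hb hcl ↦ h.2 b (hB hb) (N.closure_subset_closure
    (Set.union_subset_union_right _ (Set.sdiff_subset_sdiff_left hB)) hcl)⟩

lemma IndepMod.of_closure_subset (h : N.IndepMod X B) (hX : N.closure Y ⊆ N.closure X) :
    N.IndepMod Y B := by
  refine ⟨h.1, fun b hb hcl ↦ h.2 b hb ?_⟩
  rw [← closure_union_closure_left_eq] at hcl ⊢
  exact N.closure_subset_closure (Set.union_subset_union_left _ hX) hcl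

lemma IndepMod.mono (h : N.IndepMod X B) (hX : Y ⊆ X) : N.IndepMod Y B :=
  h.of_closure_subset (N.closure_subset_closure hX)

lemma IndepMod.indep (h : N.IndepMod X B) : N.Indep B :=
  indepMod_empty_iff.1 (h.mono (Set.empty_subset _))

lemma IndepMod.notMem_closure (h : N.IndepMod X B) {b : α} (hb : b ∈ B) : b ∉ N.closure X :=
  fun hcl ↦ h.2 b hb (N.closure_subset_closure Set.subset_union_left hcl)

/-- A circuit through `b` inside `Z ∪ B ∪ {b}` cannot meet `B`: any element of `B` on it would be
spanned by `Y` and the rest of `B`. -/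
lemma IndepMod.mem_closure_of_mem_closure_union (h : N.IndepMod Y B) (hZ : Z ⊆ Y) {b : α}
    (hb : b ∈ Y) (hcl : b ∈ N.closure (Z ∪ B)) : b ∈ N.closure Z := by
  have hbE := mem_ground_of_mem_closure hcl
  by_cases hbZ : b ∈ Z
  · exact N.mem_closure_of_mem' hbZ
  have hbB : b ∉ B := fun hbB ↦ h.notMem_closure hbB (N.mem_closure_of_mem' hb)
  obtain ⟨C, hC, hCi, hbC⟩ := exists_isCircuit_of_mem_closure hcl (by simp [hbZ, hbB])
  by_cases hCB : ∃ c ∈ C, c ∈ B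
  · obtain ⟨c, hcC, hcB⟩ := hCB
    refine (h.2 c hcB (N.closure_subset_closure ?_
      (hCi.mem_closure_sdiff_singleton_of_mem hcC))).elim
    rintro x ⟨hx, hxc⟩
    rcases hC hx with rfl | hx | hx
    · exact Or.inl hb
    · exact Or.inl (hZ hx)
    · exact Or.inr ⟨hx, hxc⟩
  · refine N.closure_subset_closure ?_ (hCi.mem_closure_sdiff_singleton_of_mem hbC)
    rintro x ⟨hx, hxb⟩
    rcases hC hx with hx | hx | hxB
    · exact (hxb hx).elim
    · exact hx
    · exact (hCB ⟨x, hx, hxB⟩).elim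

lemma IndepMod.union (hB : N.IndepMod Y B) (hB' : N.IndepMod X B') (hX : X ⊆ Y) (hBY : B' ⊆ Y) :
    N.IndepMod X (B ∪ B') := by
  refine ⟨Set.union_subset hB.1 hB'.1, ?_⟩
  rintro b hb hcl
  by_cases hbB : b ∈ B
  · refine hB.2 b hbB (N.closure_subset_closure ?_ hcl)
    rintro x (hx | ⟨hx | hx, hxb⟩)
    · exact Or.inl (hX hx)
    · exact Or.inr ⟨hx, hxb⟩
    · exact Or.inl (hBY hx)
  have hb' : b ∈ B' := hb.resolve_left hbB
  refine hB'.2 b hb' (hB.mem_closure_of_mem_closure_union (Z := X ∪ B' \ {b})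
    (Set.union_subset hX (Set.sdiff_subset.trans hBY)) (hBY hb') (N.closure_subset_closure ?_ hcl))
  rintro x (hx | ⟨hx | hx, hxb⟩)
  · exact Or.inl (Or.inl hx)
  · exact Or.inr hx
  · exact Or.inl (Or.inr ⟨hx, hxb⟩)

lemma indepMod_contract_iff : (N ／ X).IndepMod Y B ↔ N.IndepMod (X ∪ Y) B := by
  constructor
  · rintro ⟨h, h'⟩
    refine ⟨h.trans Set.sdiff_subset, fun b hb hcl ↦ h' b hb ?_⟩
    rw [contract_closure_eq]
    refine ⟨N.closure_subset_closure ?_ hcl, (h hb).2⟩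
    intro x; simp only [Set.mem_union]; tauto
  · intro h
    refine ⟨fun b hb ↦ ⟨h.1 hb, fun hbX ↦ h.notMem_closure hb
      (N.mem_closure_of_mem' (Or.inl hbX) (h.1 hb))⟩, fun b hb hcl ↦ h.2 b hb ?_⟩
    rw [contract_closure_eq] at hcl
    refine N.closure_subset_closure ?_ hcl.1
    intro x; simp only [Set.mem_union]; tauto

lemma indepMod_iff_contract_indep : N.IndepMod X B ↔ (N ／ X).Indep B := by
  rw [← indepMod_empty_iff, indepMod_contract_iff, Set.union_empty]

lemma IndepMod.union_indep (hB : N.IndepMod X B) (hI : N.Indep I) (hIX : I ⊆ X) :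
    N.Indep (B ∪ I) :=
  indepMod_empty_iff.1 (hB.union (indepMod_empty_iff.2 hI) (Set.empty_subset _) hIX)

/-- A maximal subset of `Z` independent modulo `X` spans the same as `Z` modulo `X`. -/
lemma exists_indepMod_subset_closure (N : Matroid α) (X : Set α) (hZ : Z ⊆ N.E) :
    ∃ B ⊆ Z, N.IndepMod X B ∧ N.closure (X ∪ B) = N.closure (X ∪ Z) := by
  obtain ⟨B, hB⟩ := (N ／ X).exists_isBasis' Z
  refine ⟨B, hB.subset, indepMod_iff_contract_indep.2 hB.indep, ?_⟩
  refine (N.closure_subset_closure (Set.union_subset_union_right _ hB.subset)).antisymm ?_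
  have key : ∀ x ∈ Z, x ∈ N.closure (X ∪ B) := by
    intro x hx
    by_cases hxX : x ∈ X
    · exact N.mem_closure_of_mem' (Or.inl hxX) (hZ hx)
    have : x ∈ (N ／ X).closure B := by
      rw [hB.closure_eq_closure]
      exact mem_closure_of_mem' _ hx ⟨hZ hx, hxX⟩
    rw [contract_closure_eq, Set.union_comm] at this
    exact this.1
  have : (X ∪ Z) ∩ N.E ⊆ N.closure (X ∪ B) := by
    rintro x ⟨hx | hx, hxE⟩
    · exact N.mem_closure_of_mem' (Or.inl hx) hxE
    · exact key x hx
  rw [← N.closure_inter_ground (X ∪ Z)]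
  exact closure_subset_closure_of_subset_closure this

/-- `W` is a wave for the pair `(M ／ I, N ／ I)`: some subset of `W` spans `W` in `M ／ I` and
is independent in `N ／ (N.E \ W)`. -/
def IsWave (M N : Matroid α) (I W : Set α) : Prop :=
  W ⊆ N.E \ I ∧ ∃ B ⊆ W, W ⊆ M.closure (I ∪ B) ∧ N.IndepMod (N.E \ W) B

/-- The union of all waves. -/
def maxWave (M N : Matroid α) (I : Set α) : Set α := ⋃₀ {W | M.IsWave N I W}

lemma IsWave.subset_maxWave (h : M.IsWave N I W) : W ⊆ M.maxWave N I :=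
  Set.subset_sUnion_of_mem h

/-- Well-order the waves and keep an element of a witness `f W` only if `W` is the first wave
containing it. A discarded element lies in an earlier wave, so spanning follows by induction. A
circuit violating independence is caught in the first wave `W` it meets: within `W` it uses only `f
W`. -/
lemma isWave_maxWave (hI : I ⊆ M.E) : M.IsWave N I (M.maxWave N I) := by
  classical
  have hwf : WellFounded (WellOrderingRel (α := Set α)) := WellOrderingRel.isWellOrder.wf
  choose! f hfW hfM hfN using fun W (h : M.IsWave N I W) ↦ h.2
  have hWE : M.maxWave N I ⊆ N.E \ I := Set.sUnion_subset fun W h ↦ h.1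
  set B : Set α := {x | ∃ W, M.IsWave N I W ∧ x ∈ f W ∧
    ∀ V, M.IsWave N I V → x ∈ V → ¬ WellOrderingRel V W}
    with hB
  have hBW : B ⊆ M.maxWave N I := by
    rintro x ⟨W, hW, hx, -⟩
    exact hW.subset_maxWave (hfW W hW hx)
  refine ⟨hWE, B, hBW, ?_, ?_⟩
  · have key : ∀ W, M.IsWave N I W → W ⊆ M.closure (I ∪ B) := by
      intro W
      induction W using hwf.induction with
      | h W ih =>
        intro hW
        have h1 : I ∪ f W ⊆ M.closure (I ∪ B) := by
          rintro x (hx | hx)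
          · exact M.mem_closure_of_mem' (Or.inl hx) (hI hx)
          · have hxE := mem_ground_of_mem_closure (hfM W hW (hfW W hW hx))
            by_cases h : ∀ V, M.IsWave N I V → x ∈ V → ¬ WellOrderingRel V W
            · exact M.mem_closure_of_mem' (Or.inr ⟨W, hW, hx, h⟩) hxE
            · push Not at h
              obtain ⟨V, hV, hxV, hlt⟩ := h
              exact ih V hlt hV hxV
        exact (hfM W hW).trans (M.closure_subset_closure_of_subset_closure h1)
    exact Set.sUnion_subset key
  · refine ⟨hBW.trans (hWE.trans Set.sdiff_subset), fun b hb hcl ↦ ?_⟩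
    have hbW := hBW hb
    obtain ⟨C, hC, hCi, hbC⟩ := exists_isCircuit_of_mem_closure hcl (by simp [hbW])
    have hC' : C ⊆ (N.E \ M.maxWave N I) ∪ B := by
      intro x hx
      rcases hC hx with rfl | hx | hx
      exacts [Or.inr hb, Or.inl hx, Or.inr hx.1]
    obtain ⟨W₀, hW₀, hbW₀⟩ := hbW
    have hne : {W | M.IsWave N I W ∧ (C ∩ W).Nonempty}.Nonempty := ⟨W₀, hW₀, b, hbC, hbW₀⟩
    obtain ⟨W, ⟨hW, c, hcC, hcW⟩, hmin⟩ := hwf.has_min _ hne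
    have hCW : ∀ x ∈ C, x ∈ W → x ∈ f W := by
      intro x hxC hxW
      rcases hC' hxC with hx | ⟨V, hV, hxV, hVmin⟩
      · exact (hx.2 (hW.subset_maxWave hxW)).elim
      · have h1 := hVmin W hW hxW
        have h2 := hmin V ⟨hV, x, hxC, hfW V hV hxV⟩
        rwa [← (trichotomous_of WellOrderingRel W V).resolve_left h1 |>.resolve_right h2] at hxV
    refine (hfN W hW).2 c (hCW c hcC hcW) (N.closure_subset_closure ?_
      (hCi.mem_closure_sdiff_singleton_of_mem hcC))
    rintro x ⟨hx, hxc⟩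
    by_cases hxW : x ∈ W
    · exact Or.inr ⟨hCW x hx hxW, hxc⟩
    · exact Or.inl ⟨hCi.subset_ground hx, hxW⟩

/-- For an independent `I`, membership in the closure of a subset is tested by deleting the
elements of the complement one at a time. -/
lemma Indep.mem_closure_of_forall_diff_singleton (hI : M.Indep I) (hJI : J ⊆ I) {x : α}
    (hx : x ∈ M.closure I) (h : ∀ y ∈ I \ J, x ∈ M.closure (I \ {y})) : x ∈ M.closure J := by
  by_cases hxI : x ∈ I
  · by_cases hxJ : x ∈ J
    · exact M.mem_closure_of_mem hxJ (hJI.trans hI.subset_ground)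
    · exact (hI.notMem_closure_sdiff_of_mem hxI (h x ⟨hxI, hxJ⟩)).elim
  have hC := hI.fundCircuit_isCircuit hx hxI
  refine M.closure_subset_closure ?_ (hC.mem_closure_sdiff_singleton_of_mem
    (M.mem_fundCircuit x I))
  rintro y ⟨hy, hyx⟩
  have hyI : y ∈ I := ((M.fundCircuit_subset_insert x I) hy).resolve_left hyx
  by_contra hyJ
  have h1 := (hI.mem_fundCircuit_iff hx hxI).1 hy
  have h2 := h y ⟨hyI, hyJ⟩
  have hne : x ≠ y := fun h ↦ hyx h.symm
  rw [← Set.insert_sdiff_singleton_comm hne,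
    (hI.subset Set.sdiff_subset).insert_indep_iff_of_notMem (fun h ↦ hxI h.1)] at h1
  exact h1.2 h2

end


/-! ### Alternating paths and augmentation -/

section

variable {α : Type*} {M N : Matroid α} {X Y Z I J : Set α} {e f x x' y z : α} {n k : ℕ}

lemma closure_insert_sdiff_eq (hy : y ∈ I) (hz : z ∈ N.closure I)
    (hzy : z ∉ N.closure (I \ {y})) : N.closure (insert z (I \ {y})) = N.closure I := by
  have h : insert y (I \ {y}) = I := Set.insert_sdiff_self_of_mem hy
  rw [N.closure_insert_congr (f := y) ⟨by rwa [h], hzy⟩, h]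

lemma Indep.insert_of_notMem_closure (hI : M.Indep I) (hx : x ∈ M.E) (hxI : x ∉ M.closure I) :
    M.Indep (insert x I) :=
  hI.insert_indep_iff.2 (Or.inl ⟨hx, hxI⟩)

lemma Indep.mem_closure_inter_of_mem (hI : M.Indep I) (hX : X ⊆ I) (hY : Y ⊆ I)
    (hxX : x ∈ M.closure X) (hxY : x ∈ M.closure Y) : x ∈ M.closure (X ∩ Y) := by
  rw [(hI.subset (Set.union_subset hX hY)).closure_inter_eq_inter_closure]
  exact ⟨hxX, hxY⟩

/-- Two consecutive arcs `x → y → x'` of the exchange digraph of a common independent set `I`: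
`y ∈ I` lies in the fundamental `M`-circuit of `x` and in the fundamental `N`-circuit of `x'`. -/
def ExchangeStep (M N : Matroid α) (I : Set α) (x x' : α) : Prop :=
  ∃ y ∈ I, x ∈ M.closure I ∧ x ∉ M.closure (I \ {y}) ∧ x' ∈ N.closure I ∧
    x' ∉ N.closure (I \ {y})

/-- The elements reachable from `X` by at most `n` exchange steps. -/
def reachLevel (M N : Matroid α) (I X : Set α) : ℕ → Set α
  | 0 => X
  | n + 1 => M.reachLevel N I X n ∪ {x' | ∃ x ∈ M.reachLevel N I X n, M.ExchangeStep N I x x'}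

/-- The elements reachable from `X` by exchange steps. -/
def reach (M N : Matroid α) (I X : Set α) : Set α := ⋃ n, M.reachLevel N I X n

/-- An element `y` of `I` may itself be either end of a step through `y`. Closed sets therefore also
contain the elements of `I` that alternating paths pass through. -/
def IsExchangeClosed (M N : Matroid α) (I Z : Set α) : Prop :=
  ∀ x ∈ Z, ∀ x', M.ExchangeStep N I x x' → x' ∈ Z

lemma reachLevel_mono : Monotone (M.reachLevel N I X) :=
  monotone_nat_of_le_succ fun _ ↦ Set.subset_union_left

lemma subset_reach : X ⊆ M.reach N I X :=
  Set.subset_iUnion (M.reachLevel N I X) 0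

lemma isExchangeClosed_reach : M.IsExchangeClosed N I (M.reach N I X) := by
  intro x hx x' h
  obtain ⟨n, hn⟩ := Set.mem_iUnion.1 hx
  exact Set.mem_iUnion.2 ⟨n + 1, Or.inr ⟨x, hn, h⟩⟩

lemma reach_subset (hX : X ⊆ Z) (h : ∀ x ∈ Z, ∀ x', M.ExchangeStep N I x x' → x' ∈ Z) :
    M.reach N I X ⊆ Z := by
  refine Set.iUnion_subset fun n ↦ ?_
  induction n with
  | zero => exact hX
  | succ n ih =>
    rintro x' (hx | ⟨x, hx, hxx'⟩)
    exacts [ih hx, h x (ih hx) x' hxx']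

lemma reach_mono (h : X ⊆ Y) : M.reach N I X ⊆ M.reach N I Y :=
  reach_subset (h.trans subset_reach) isExchangeClosed_reach

lemma reach_subset_ground (hX : X ⊆ N.E) : M.reach N I X ⊆ N.E :=
  reach_subset hX fun _ _ _ ⟨_, _, _, _, h, _⟩ ↦ mem_ground_of_mem_closure h

lemma ExchangeStep.of_subset (h : M.ExchangeStep N I x x') (hIJ : I ⊆ J) (hM : M.Indep J)
    (hN : N.Indep J) : M.ExchangeStep N J x x' := by
  obtain ⟨y, hy, h1, h2, h3, h4⟩ := h
  have key : J \ {y} ∩ I = I \ {y} := by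
    ext a; have := @hIJ a; simp only [Set.mem_inter_iff, Set.mem_sdiff]; tauto
  refine ⟨y, hIJ hy, M.closure_subset_closure hIJ h1, fun h ↦ h2 ?_,
    N.closure_subset_closure hIJ h3, fun h ↦ h4 ?_⟩
  · exact key ▸ hM.mem_closure_inter_of_mem Set.sdiff_subset hIJ h h1
  · exact key ▸ hN.mem_closure_inter_of_mem Set.sdiff_subset hIJ h h3

/-- An exchange-closed set of `M`-spanned elements splits a common independent set. -/
lemma IsExchangeClosed.subset_closure_inter (h : M.IsExchangeClosed N I Z) (hM : M.Indep I)
    (hIN : I ⊆ N.E) (hN : N.Indep I) (hZ : Z ⊆ M.closure I) : Z ⊆ M.closure (I ∩ Z) := by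
  intro x hx
  refine hM.mem_closure_of_forall_diff_singleton Set.inter_subset_left (hZ hx) fun y hy ↦ ?_
  by_contra hxy
  exact hy.2 ⟨hy.1, h x hx y ⟨y, hy.1, hZ hx, hxy, N.mem_closure_of_mem hy.1 hIN,
    hN.notMem_closure_sdiff_of_mem hy.1⟩⟩

/-- If spanning `x` in `N` needed some `y ∈ I ∩ Z`, the step from `y` through `y` to `x` would put
`x` into `Z`. -/
lemma IsExchangeClosed.closure_sdiff_subset (h : M.IsExchangeClosed N I Z) (hM : M.Indep I)
    (hN : N.Indep I) : N.closure I \ Z ⊆ N.closure (I \ Z) := by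
  rintro x ⟨hx, hxZ⟩
  refine hN.mem_closure_of_forall_diff_singleton Set.sdiff_subset hx fun y hy ↦ ?_
  by_contra hxy
  refine hxZ (h y (by_contra fun hyZ ↦ hy.2 ⟨hy.1, hyZ⟩) x ⟨y, hy.1,
    M.mem_closure_of_mem hy.1 hM.subset_ground, hM.notMem_closure_sdiff_of_mem hy.1, hx, hxy⟩)

/-- If `z` enters `I` for `y` then elements from which no exchange step leads to `z` keep
their exchange steps. -/
lemma exchangeStep_insert_sdiff_iff (hy : y ∈ I)
    (hz : z ∈ N.closure I) (hzy : z ∉ N.closure (I \ {y})) (hzM : z ∉ M.closure I)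
    (hMI : M.Indep (insert z (I \ {y}))) (hI : M.Indep I)
    (hx : x ∈ M.closure I) (hxz : ¬ M.ExchangeStep N I x z) :
    x ∈ M.closure (insert z (I \ {y})) ∧
      (M.ExchangeStep N (insert z (I \ {y})) x x' ↔ M.ExchangeStep N I x x') := by
  have hxy : x ∈ M.closure (I \ {y}) := by_contra fun h ↦ hxz ⟨y, hy, hx, h, hz, hzy⟩
  have hz' : ∀ y' ∈ I, x ∉ M.closure (I \ {y'}) → z ∈ N.closure (I \ {y'}) :=
    fun y' hy' h ↦ by_contra fun h' ↦ hxz ⟨y', hy', hx, h, hz, h'⟩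
  have hzI : z ∉ I := fun h ↦ hzM (M.mem_closure_of_mem h hI.subset_ground)
  have hxI1 := M.closure_subset_closure (Set.subset_insert z (I \ {y})) hxy
  have hcl := closure_insert_sdiff_eq hy hz hzy
  -- Since `x` is spanned by `I \ {y}`, its fundamental `M`-circuit is the same for both sets.
  have hMstep : ∀ y', (y' ∈ insert z (I \ {y}) ∧ x ∉ M.closure (insert z (I \ {y}) \ {y'})) ↔
      (y' ∈ I ∧ x ∉ M.closure (I \ {y'})) := by
    intro y'
    constructor
    · rintro ⟨h1, h2⟩
      have hy'z : y' ≠ z := by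
        rintro rfl
        refine h2 (M.closure_subset_closure ?_ hxy)
        intro a ha
        exact ⟨Or.inr ha, fun h ↦ hzI (h ▸ ha.1)⟩
      have hy'I := (h1.resolve_left hy'z).1
      refine ⟨hy'I, fun h ↦ h2 (M.closure_subset_closure ?_
        (hI.mem_closure_inter_of_mem Set.sdiff_subset Set.sdiff_subset h hxy))⟩
      rintro a ⟨ha, ha'⟩
      exact ⟨Or.inr ha', ha.2⟩
    · rintro ⟨h1, h2⟩
      have hne : y' ≠ y := by rintro rfl; exact h2 hxy
      refine ⟨Or.inr ⟨h1, hne⟩, fun h ↦ h2 (M.closure_subset_closure ?_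
        (hMI.mem_closure_inter_of_mem Set.sdiff_subset (Set.subset_insert _ _) h hxy))⟩
      rintro a ⟨ha, ha'⟩
      exact ⟨ha'.1, ha.2⟩
  -- As no step leads from `x` to `z`, `I \ {y'}` already spans `z` in `N`, and trading `y` for `z`
  -- inside it keeps its span.
  have hNstep : ∀ y' ∈ I, x ∉ M.closure (I \ {y'}) →
      N.closure (insert z (I \ {y}) \ {y'}) = N.closure (I \ {y'}) := by
    intro y' hy' h
    have hne : y ≠ y' := by rintro rfl; exact h hxy
    have hne' : z ≠ y' := by rintro rfl; exact hzI hy'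
    have heq : insert z (I \ {y}) \ {y'} = insert z ((I \ {y'}) \ {y}) := by
      ext a
      simp only [Set.mem_sdiff, Set.mem_insert_iff, Set.mem_singleton_iff]
      constructor
      · tauto
      · rintro (rfl | h) <;> tauto
    rw [heq]
    refine closure_insert_sdiff_eq ⟨hy, hne⟩ (hz' y' hy' h) fun h' ↦ hzy ?_
    refine N.closure_subset_closure ?_ h'
    rintro a ⟨⟨ha, -⟩, ha'⟩
    exact ⟨ha, ha'⟩
  refine ⟨hxI1, ?_, ?_⟩
  · rintro ⟨y', h1, h2, h3, h4, h5⟩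
    obtain ⟨h1', h3'⟩ := (hMstep y').1 ⟨h1, h3⟩
    exact ⟨y', h1', hx, h3', hcl ▸ h4, hNstep y' h1' h3' ▸ h5⟩
  · rintro ⟨y', h1, h2, h3, h4, h5⟩
    obtain ⟨h1', h3'⟩ := (hMstep y').2 ⟨h1, h3⟩
    exact ⟨y', h1', hxI1, h3', hcl.symm ▸ h4, (hNstep y' h1 h3).symm ▸ h5⟩

/-- `J` agrees with `I` on every exchange-closed set of `M`-spanned elements and keeps the exchange
steps there. -/
def Preserves (M N : Matroid α) (I J : Set α) : Prop :=
  ∀ Z, M.IsExchangeClosed N I Z → Z ⊆ M.closure I →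
    I ∩ Z ⊆ J ∧ ∀ x ∈ Z, ∀ x', M.ExchangeStep N I x x' → M.ExchangeStep N J x x'

/-- Augmentation along a shortest alternating path from `x` to `z`. -/
lemma exists_augment (hx : x ∈ M.E) (hxN : x ∈ N.E) (hzE : z ∈ M.E) (hMI : M.Indep I)
    (hNI : N.Indep I) (hxI : x ∉ N.closure I)
    (hz : z ∈ M.reachLevel N I {x} n) (hzI : z ∉ M.closure I)
    (hlt : ∀ k < n, M.reachLevel N I {x} k ⊆ M.closure I) :
    ∃ J, M.Indep J ∧ N.Indep J ∧ M.closure J = M.closure (insert z I) ∧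
      N.closure J = N.closure (insert x I) ∧ M.Preserves N I J := by
  induction n generalizing I z with
  | zero =>
    obtain rfl : z = x := hz
    have h1 := hMI.insert_of_notMem_closure hx hzI
    have h2 := hNI.insert_of_notMem_closure hxN hxI
    exact ⟨insert z I, h1, h2, rfl, rfl, fun Z hZ hZI ↦
      ⟨fun a ha ↦ Or.inr ha.1, fun a ha a' h ↦ h.of_subset (Set.subset_insert _ _) h1 h2⟩⟩
  | succ n ih =>
    -- Perform the last exchange of the path first: `z` replaces `y`, and the predecessor `w` of `z`
    -- becomes the new end of a shorter path.
    obtain ⟨w, hw, y, hy, hwI, hwy, hzN, hzy⟩ := hz.resolve_left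
      fun h ↦ hzI (hlt n n.lt_succ_self h)
    set I₁ := insert z (I \ {y}) with hI₁
    have hM₁ : M.Indep I₁ := (hMI.subset Set.sdiff_subset).insert_of_notMem_closure hzE
      fun h ↦ hzI (M.closure_subset_closure Set.sdiff_subset h)
    have hN₁ : N.Indep I₁ := (hNI.subset Set.sdiff_subset).insert_of_notMem_closure
      (mem_ground_of_mem_closure hzN) hzy
    have hcl : N.closure I₁ = N.closure I := closure_insert_sdiff_eq hy hzN hzy
    have hstep : ∀ {a a'}, a ∈ M.closure I → ¬ M.ExchangeStep N I a z →
        a ∈ M.closure I₁ ∧ (M.ExchangeStep N I₁ a a' ↔ M.ExchangeStep N I a a') :=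
      fun ha haz ↦ exchangeStep_insert_sdiff_iff hy hzN hzy hzI hM₁ hMI ha haz
    have hnz : ∀ k < n, ∀ a ∈ M.reachLevel N I {x} k, ¬ M.ExchangeStep N I a z :=
      fun k hk a ha haz ↦ hzI (hlt n n.lt_succ_self
        (reachLevel_mono (Nat.succ_le_of_lt hk) (Or.inr ⟨a, ha, haz⟩)))
    -- Minimality of the path: no step from a level below `n` leads to `z`, so those steps survive
    -- the exchange.
    have hlevel : ∀ k ≤ n, M.reachLevel N I₁ {x} k = M.reachLevel N I {x} k := by
      intro k
      induction k with
      | zero => exact fun _ ↦ rfl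
      | succ k ihk =>
        intro hk
        have hk' := ihk (Nat.le_of_succ_le hk)
        simp only [reachLevel, hk']
        congr 1
        ext a'
        refine exists_congr fun a ↦ and_congr_right fun ha ↦ ?_
        exact (hstep (hlt k (by omega) ha) (hnz k hk a ha)).2
    have hwI₁ : w ∉ M.closure I₁ := by
      intro h
      have h' : z ∈ M.closure (insert w (I \ {y})) := mem_closure_insert hwy h
      refine hzI (closure_subset_closure_of_subset_closure ?_ h')
      exact Set.insert_subset hwI ((M.subset_closure I hMI.subset_ground).trans'
        Set.sdiff_subset)
    have hwcl : M.closure (insert w I₁) = M.closure (insert z I) := by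
      rw [hI₁, Set.insert_comm]
      have := closure_insert_sdiff_eq (N := M) hy hwI hwy
      rw [← M.closure_insert_closure_eq_closure_insert, this,
        M.closure_insert_closure_eq_closure_insert]
    obtain ⟨J, hJM, hJN, hJM', hJN', hJ⟩ := ih (mem_ground_of_mem_closure hwI) hM₁ hN₁
      (by rwa [hcl]) (by rwa [hlevel n le_rfl]) hwI₁ (fun k hk ↦ by
        rw [hlevel k hk.le]
        exact fun a ha ↦ (hstep (a' := a) (hlt k (by omega) ha) (hnz k hk a ha)).1)
    refine ⟨J, hJM, hJN, hJM'.trans hwcl, ?_, ?_⟩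
    · rw [hJN', ← N.closure_insert_closure_eq_closure_insert, hcl,
        N.closure_insert_closure_eq_closure_insert]
    · intro Z hZ hZI
      have hzZ : z ∉ Z := fun h ↦ hzI (hZI h)
      have hst : ∀ {a a'}, a ∈ Z →
          a ∈ M.closure I₁ ∧ (M.ExchangeStep N I₁ a a' ↔ M.ExchangeStep N I a a') :=
        fun ha ↦ hstep (hZI ha) fun h ↦ hzZ (hZ _ ha _ h)
      have hyZ : y ∉ Z := fun h ↦ hzZ (hZ y h z ⟨y, hy, M.mem_closure_of_mem hy hMI.subset_ground,
        hMI.notMem_closure_sdiff_of_mem hy, hzN, hzy⟩)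
      obtain ⟨h1, h2⟩ := hJ Z (fun a ha a' h ↦ hZ a ha a' ((hst ha).2.1 h))
        (fun a ha ↦ (hst (a' := a) ha).1)
      refine ⟨fun a ha ↦ h1 ⟨Or.inr ⟨ha.1, fun h ↦ hyZ (h ▸ ha.2)⟩, ha.2⟩, fun a ha a' h ↦ ?_⟩
      exact h2 a ha a' ((hst ha).2.2 h)

lemma exists_augment_of_reach (hx : x ∈ M.E) (hxN : x ∈ N.E) (hE : N.E ⊆ M.E) (hMI : M.Indep I)
    (hNI : N.Indep I) (hxI : x ∉ N.closure I) (h : ¬ M.reach N I {x} ⊆ M.closure I) :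
    ∃ z ∈ M.reach N I {x}, z ∈ M.E ∧ z ∉ M.closure I ∧
    ∃ J, M.Indep J ∧ N.Indep J ∧ M.closure J = M.closure (insert z I) ∧
      N.closure J = N.closure (insert x I) ∧ M.Preserves N I J := by
  classical
  have hex : ∃ n, ¬ M.reachLevel N I {x} n ⊆ M.closure I := by
    by_contra! hcon
    exact h (Set.iUnion_subset hcon)
  obtain ⟨z, hz, hzI⟩ := Set.not_subset.1 (Nat.find_spec hex)
  have hzr : z ∈ M.reach N I {x} := Set.mem_iUnion.2 ⟨_, hz⟩
  have hzE : z ∈ M.E := hE (reach_subset_ground (by simpa using hxN) hzr)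
  exact ⟨z, hzr, hzE, hzI, exists_augment hx hxN hzE hMI hNI hxI hz hzI
    fun k hk ↦ not_not.1 (Nat.find_min hex hk)⟩

end


/-! ### Nice sets and their extension -/

section

variable {α : Type*} {M N : Matroid α} {X Y Z I J W B : Set α} {e f x x' y z : α} {n k : ℕ}

lemma reach_subset_of_forall (h : ∀ x ∈ X, M.reach N I {x} ⊆ Y) : M.reach N I X ⊆ Y := by
  refine (reach_subset (Z := ⋃ x ∈ X, M.reach N I {x}) ?_ ?_).trans (Set.iUnion₂_subset h)
  · exact fun x hx ↦ Set.mem_biUnion hx (subset_reach rfl)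
  · intro a ha a' haa'
    obtain ⟨x, hx, hax⟩ := Set.mem_iUnion₂.1 ha
    exact Set.mem_biUnion hx (isExchangeClosed_reach a hax a' haa')

/-- A common independent set `I` of `M` and `N` such that every wave for `(M ／ I, N ／ I)` consists
of loops of `M ／ I`, and these loops may be deleted without decreasing the rank of `N ／ I`. -/
structure IsNice (M N : Matroid α) (I : Set α) : Prop where
  indep_left : M.Indep I
  indep_right : N.Indep I
  spanning : N.E ⊆ N.closure (N.E \ M.closure I ∪ I)
  wave_subset : ∀ W, M.IsWave N I W → W ⊆ M.closure I

/-- A maximal wave with a set `B` witnessing it can be contracted. -/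
lemma exists_maxWave_basis (hE : M.E = N.E) (hM : M.Indep I) (hN : N.Indep I) :
    ∃ B ⊆ M.maxWave N I, M.Indep (I ∪ B) ∧ N.Indep (I ∪ B) ∧ M.IndepMod I B ∧
      N.IndepMod (N.E \ M.maxWave N I) B ∧ M.closure (I ∪ B) = I ∪ M.maxWave N I ∧
      ∀ W, M.IsWave N (I ∪ B) W → W ⊆ M.maxWave N I := by
  obtain ⟨hWE, B₀, hB₀W, hB₀M, hB₀N⟩ := isWave_maxWave (M := M) (N := N) hM.subset_ground
  set W₀ := M.maxWave N I with hW₀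
  obtain ⟨B, hBB₀, hBM, hBcl⟩ := M.exists_indepMod_subset_closure I (hB₀N.1.trans hE.symm.subset)
  have hBN := hB₀N.subset hBB₀
  have hBW := hBB₀.trans hB₀W
  rw [← hBcl] at hB₀M
  have hIW : I ⊆ N.E \ W₀ := fun x hx ↦ ⟨hN.subset_ground hx, fun h ↦ (hWE h).2 hx⟩
  refine ⟨B, hBW, ?_, ?_, hBM, hBN, ?_, ?_⟩
  · rw [Set.union_comm]; exact hBM.union_indep hM subset_rfl
  · rw [Set.union_comm]; exact hBN.union_indep hN hIW
  · refine Set.Subset.antisymm ?_ (Set.union_subset (M.subset_closure_of_subset'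
      Set.subset_union_left hM.subset_ground) hB₀M)
    -- Adding everything that `I ∪ B` spans in `M` gives a wave with the same witness, so maximality
    -- applies.
    have hw : M.IsWave N I (W₀ ∪ M.closure (I ∪ B) \ I) := by
      refine ⟨Set.union_subset hWE fun x hx ↦ ⟨hE ▸ mem_ground_of_mem_closure hx.1, hx.2⟩, B,
        hBW.trans Set.subset_union_left, Set.union_subset hB₀M Set.sdiff_subset, hBN.mono ?_⟩
      exact Set.sdiff_subset_sdiff_right Set.subset_union_left
    intro x hx
    by_cases hxI : x ∈ I
    · exact Or.inl hxI
    · exact Or.inr (hw.subset_maxWave (Or.inr ⟨hx, hxI⟩))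
  · rintro W ⟨hWE', B₁, hB₁W, hB₁M, hB₁N⟩
    have hw : M.IsWave N I (W ∪ W₀) := by
      refine ⟨Set.union_subset (fun x hx ↦ ⟨(hWE' hx).1, fun h ↦ (hWE' hx).2 (Or.inl h)⟩) hWE,
        B ∪ B₁ \ W₀, Set.union_subset (hBW.trans Set.subset_union_right)
          ((Set.sdiff_subset.trans hB₁W).trans Set.subset_union_left), ?_, ?_⟩
      · have h₀ : W₀ ⊆ M.closure (I ∪ (B ∪ B₁ \ W₀)) := hB₀M.trans (M.closure_subset_closure
          (Set.union_subset_union_right _ Set.subset_union_left))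
        refine Set.union_subset (hB₁M.trans (closure_subset_closure_of_subset_closure ?_)) h₀
        have h₂ : ∀ S ⊆ M.E, S ⊆ I ∪ (B ∪ B₁ \ W₀) → S ⊆ M.closure (I ∪ (B ∪ B₁ \ W₀)) :=
          fun S hS h ↦ M.subset_closure_of_subset' h hS
        rintro x ((hx | hx) | hx)
        · exact h₂ I hM.subset_ground Set.subset_union_left hx
        · exact h₀ (hBW hx)
        · by_cases hxW : x ∈ W₀
          · exact h₀ hxW
          · exact M.mem_closure_of_mem' (Or.inr (Or.inr ⟨hx, hxW⟩)) (hE ▸ hB₁N.1 hx)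
      · refine hBN.union ((hB₁N.subset Set.sdiff_subset).mono
          (Set.sdiff_subset_sdiff_right Set.subset_union_left))
          (Set.sdiff_subset_sdiff_right Set.subset_union_right) fun x hx ↦ ⟨hB₁N.1 hx.1, hx.2⟩
    exact Set.subset_union_left.trans hw.subset_maxWave

/-- A common independent set of deficiency one in a minor of `(M, N)`, where `M` is nice,
spans that minor in `N`. -/
lemma IsNice.subset_closure_of_insert (hE : M.E = N.E) (hI : M.IsNice N I) (hWE : W ⊆ N.E \ I)
    (hBW : B ⊆ W) (hBM : M.IndepMod I B) (hBN : N.IndepMod (N.E \ W) B) (hzW : z ∈ W)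
    (hzI : z ∉ M.closure I) (hz : W ⊆ M.closure (insert z (I ∪ B))) :
    W ⊆ N.closure (N.E \ W ∪ B) := by
  by_contra hcon
  set M' := (M ／ I) ↾ W with hM'
  set N' := N ／ (N.E \ W) with hN'
  have hWI : Disjoint W I := Set.disjoint_left.2 fun x hx ↦ (hWE hx).2
  have hWN : W ⊆ N.E := hWE.trans Set.sdiff_subset
  have hWM : W ⊆ (M ／ I).E := by rw [contract_ground, hE]; exact hWE
  have hclM : ∀ X ⊆ W, M'.closure X = M.closure (I ∪ X) ∩ W := by
    intro X hX
    rw [hM', restrict_closure_eq _ hX hWM, contract_closure_eq, Set.union_comm]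
    ext x
    simp only [Set.mem_inter_iff, Set.mem_sdiff]
    exact ⟨fun h ↦ ⟨h.1.1, h.2⟩, fun h ↦ ⟨⟨h.1, (hWE h.2).2⟩, h.2⟩⟩
  have hclN : ∀ X, N'.closure X = N.closure (N.E \ W ∪ X) ∩ W := by
    intro X
    rw [hN', contract_closure_eq, Set.union_comm]
    ext x
    have := N.closure_subset_ground (N.E \ W ∪ X)
    simp only [Set.mem_inter_iff, Set.mem_sdiff]
    exact ⟨fun h ↦ ⟨h.1, by_contra fun hx ↦ h.2 ⟨this h.1, hx⟩⟩, fun h ↦ ⟨h.1, fun hx ↦ hx.2 h.2⟩⟩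
  have hM'E : M'.E = W := rfl
  have hN'E : N'.E = W := by
    rw [hN', contract_ground, Set.sdiff_sdiff_cancel_left hWN]
  have hBM' : M'.Indep B := restrict_indep_iff.2 ⟨indepMod_iff_contract_indep.1 hBM, hBW⟩
  have hBN' : N'.Indep B := indepMod_iff_contract_indep.1 hBN
  have hIE := hI.indep_left.subset_ground
  set X := W \ N'.closure B with hX
  -- An augmentation removes the deficiency of one, so all of `W` would be a wave, although `z ∈ W`
  -- is no loop of `M ／ I`. Without an augmentation, the set reachable from the unspanned elements
  -- is a wave.
  by_cases haug : ∃ x ∈ X, ¬ M'.reach N' B {x} ⊆ M'.closure B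
  · obtain ⟨x, hx, hreach⟩ := haug
    obtain ⟨w, -, hwE, hwB, B', hB'M, hB'N, hB'cl, -, -⟩ := exists_augment_of_reach (M := M')
      (N := N') (x := x) (hM'E ▸ hx.1) (hN'E ▸ hx.1) (by rw [hM'E, hN'E]) hBM' hBN' hx.2 hreach
    have hB'W : B' ⊆ W := hB'M.subset_ground
    rw [hM'E] at hwE
    have hw : w ∉ M.closure (I ∪ B) := fun h ↦ hwB (by rw [hclM B hBW]; exact ⟨h, hwE⟩)
    have hwz : M.closure (insert w (I ∪ B)) = M.closure (insert z (I ∪ B)) :=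
      closure_insert_congr ⟨hz hwE, hw⟩
    have hWB' : W ⊆ M.closure (I ∪ B') := by
      have h1 : W ⊆ M'.closure B' := by
        rw [hB'cl, hclM _ (Set.insert_subset hwE hBW), Set.union_insert, hwz]
        exact Set.subset_inter hz subset_rfl
      rw [hclM _ hB'W] at h1
      exact h1.trans Set.inter_subset_left
    exact hzI (hI.wave_subset W ⟨hWE, B', hB'W, hWB', indepMod_iff_contract_indep.2 hB'N⟩ hzW)
  · push Not at haug
    set R := M'.reach N' B X with hR
    have hRW : R ⊆ W := hN'E ▸ reach_subset_ground (hN'E.symm ▸ Set.sdiff_subset)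
    have hRM : R ⊆ M'.closure B := reach_subset_of_forall haug
    have hcl : M'.IsExchangeClosed N' B R := isExchangeClosed_reach
    have h1 := hcl.subset_closure_inter hBM' (hN'E.symm ▸ hBW) hBN' hRM
    have h2 := hcl.closure_sdiff_subset hBM' hBN'
    have hWR : W \ R ⊆ N.closure (N.E \ W ∪ B \ R) := by
      refine fun x hx ↦ (hclN _ ▸ h2 ⟨?_, hx.2⟩ : x ∈ _ ∩ W).1
      by_contra h
      exact hx.2 (subset_reach ⟨hx.1, h⟩)
    have hER : N.closure (N.E \ R) ⊆ N.closure (N.E \ W ∪ B \ R) := by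
      refine closure_subset_closure_of_subset_closure fun x hx ↦ ?_
      by_cases hxW : x ∈ W
      · exact hWR ⟨hxW, hx.2⟩
      · exact N.mem_closure_of_mem' (Or.inl ⟨hx.1, hxW⟩) hx.1
    have hwave : M.IsWave N I R := by
      refine ⟨hRW.trans hWE, B ∩ R, Set.inter_subset_right, ?_, ?_⟩
      · rw [hclM _ (Set.inter_subset_left.trans hBW)] at h1
        exact h1.trans Set.inter_subset_left
      · refine IndepMod.of_closure_subset (X := N.E \ W ∪ B \ R) ?_ hER
        refine ⟨Set.inter_subset_left.trans hBN.1, fun b hb hcl ↦ hBN.2 b hb.1 ?_⟩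
        refine N.closure_subset_closure ?_ hcl
        rintro a ((ha | ha) | ha)
        · exact Or.inl ha
        · exact Or.inr ⟨ha.1, fun h ↦ ha.2 (h ▸ hb.2)⟩
        · exact Or.inr ⟨ha.1.1, ha.2⟩
    -- By niceness `R` consists of loops of `M ／ I`, so its complement spans `N`; that complement is
    -- in turn spanned by `N.E \ W ∪ B \ R`.
    have hRI := hI.wave_subset R hwave
    refine hcon fun y hy ↦ ?_
    refine closure_subset_closure_of_subset_closure ?_ (hI.spanning (hWN hy))
    refine Set.Subset.trans ?_ (hER.trans (N.closure_subset_closure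
      (Set.union_subset_union_right _ Set.sdiff_subset)))
    refine N.subset_closure_of_subset' ?_ (Set.union_subset Set.sdiff_subset
      hI.indep_right.subset_ground)
    rintro x (hx | hx)
    · exact ⟨hx.1, fun h ↦ hx.2 (hRI h)⟩
    · exact ⟨hI.indep_right.subset_ground hx, fun h ↦ (hWE (hRW h)).2 hx⟩

/-- An augmentation may create new waves; adding a witness `B` of the maximal one absorbs them. The
rank condition in `N` survives because, relative to the old `I`, `B` falls short of spanning the
absorbed set in `M` by the single element `z`. -/
lemma IsNice.exists_nice_superset (hE : M.E = N.E) (hI : M.IsNice N I) (hJM : M.Indep J)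
    (hJN : N.Indep J) (hzE : z ∈ M.E) (hzI : z ∉ M.closure I)
    (hM : M.closure J = M.closure (insert z I)) (hN : N.closure J = N.closure (insert x I)) :
    ∃ K, J ⊆ K ∧ M.IsNice N K := by
  obtain ⟨B, hBW, hM', hN', hBM, hBN, hcl, hw⟩ := exists_maxWave_basis hE hJM hJN
  set W₀ := M.maxWave N J with hW₀
  have hIM := hI.indep_left.subset_ground
  have hIN := hI.indep_right.subset_ground
  have hS : M.closure (J ∪ B) ⊆ N.E := hE ▸ M.closure_subset_ground _
  have hIJM : I ⊆ M.closure J := by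
    rw [hM]; exact M.subset_closure_of_subset' (Set.subset_insert _ _) hIM
  have hIJN : I ⊆ N.closure J := by
    rw [hN]; exact N.subset_closure_of_subset' (Set.subset_insert _ _) hIN
  have hIS : I ⊆ M.closure (J ∪ B) :=
    hIJM.trans (M.closure_subset_closure Set.subset_union_left)
  have hJE := hJN.subset_ground
  have hJW : Disjoint J W₀ := by
    rw [Set.disjoint_left]
    exact fun x hx hxW ↦ ((isWave_maxWave (N := N) hJM.subset_ground).1 hxW).2 hx
  have hJS : J ⊆ M.closure (J ∪ B) := M.subset_closure_of_subset' Set.subset_union_left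
    hJM.subset_ground
  set W := M.closure (J ∪ B) \ I with hW
  have hEW : N.closure (N.E \ W) ⊆ N.closure (N.E \ W₀) := by
    refine closure_subset_closure_of_subset_closure fun a ha ↦ ?_
    by_cases haS : a ∈ M.closure (J ∪ B)
    · have haI : a ∈ I := by_contra fun h ↦ ha.2 ⟨haS, h⟩
      exact N.closure_subset_closure (Set.subset_sdiff.2 ⟨hJE, hJW⟩) (hIJN haI)
    · exact N.mem_closure_of_mem' ⟨ha.1, fun h ↦ haS (hcl ▸ Or.inr h)⟩ ha.1
  have hBI : ∀ b ∈ B, b ∉ I := fun b hb h ↦ hBM.notMem_closure hb (hIJM h)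
  have hspan : W ⊆ N.closure (N.E \ W ∪ B) := by
    refine hI.subset_closure_of_insert (z := z) hE
      (Set.sdiff_subset_sdiff_left hS) ?_ ?_ ?_ ?_ hzI ?_
    · exact fun b hb ↦ ⟨hcl ▸ Or.inr (hBW hb), hBI b hb⟩
    · exact hBM.of_closure_subset (closure_subset_closure_of_subset_closure hIJM)
    · exact hBN.of_closure_subset hEW
    · refine ⟨M.closure_subset_closure Set.subset_union_left
        (hM ▸ M.mem_closure_of_mem' (Set.mem_insert _ _) hzE), fun h ↦ hzI ?_⟩
      exact M.mem_closure_of_mem h hIM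
    · rw [← Set.insert_union, ← closure_union_closure_left_eq, ← hM, closure_union_closure_left_eq]
      exact Set.sdiff_subset
  refine ⟨J ∪ B, Set.subset_union_left, hM', hN', ?_, ?_⟩
  · have hxJ : N.closure (N.E \ W) ⊆ N.closure (N.E \ M.closure (J ∪ B) ∪ (J ∪ B)) := by
      refine closure_subset_closure_of_subset_closure fun a ha ↦ ?_
      by_cases haS : a ∈ M.closure (J ∪ B)
      · have haI : a ∈ I := by_contra fun h ↦ ha.2 ⟨haS, h⟩
        exact N.closure_subset_closure
          (Set.subset_union_left.trans Set.subset_union_right) (hIJN haI)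
      · exact N.mem_closure_of_mem' (Or.inl ⟨ha.1, haS⟩) ha.1
    intro a ha
    by_cases haW : a ∈ W
    · refine closure_subset_closure_of_subset_closure ?_ (hspan haW)
      refine Set.union_subset ((N.subset_closure _ Set.sdiff_subset).trans hxJ)
        (N.subset_closure_of_subset' (Set.subset_union_right.trans Set.subset_union_right) hBN.1)
    · exact hxJ (N.mem_closure_of_mem' ⟨ha, haW⟩ ha)
  · exact fun W' hW' ↦ (hw W' hW').trans (hcl ▸ Set.subset_union_right)

end


/-! ### Spanning one prescribed element -/

section

variable {α : Type*} {M N : Matroid α} {X Y Z I J W B : Set α} {e f x x' y z : α} {n k : ℕ}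

/-- Some alternating path from `x` augments `I`. -/
def IsAugmentable (M N : Matroid α) (I : Set α) (x : α) : Prop :=
  x ∈ N.E ∧ x ∉ N.closure I ∧ ¬ M.reach N I {x} ⊆ M.closure I

lemma Preserves.of_subset (h : M.Preserves N I J) (hJ : J ⊆ Y) (hM : M.Indep Y) (hN : N.Indep Y) :
    M.Preserves N I Y := fun Z hZ hZI ↦
  ⟨(h Z hZ hZI).1.trans hJ, fun a ha a' haa' ↦ ((h Z hZ hZI).2 a ha a' haa').of_subset hJ hM hN⟩

/-- Augment from an augmentable element of least label, then restore niceness. Without an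
augmentable element, `J = I` serves. -/
lemma IsNice.exists_augment_least (hE : M.E = N.E) (hI : M.IsNice N I) (g : α → ℕ) :
    ∃ J, M.IsNice N J ∧ N.closure I ⊆ N.closure J ∧ M.Preserves N I J ∧
      ∀ x, M.IsAugmentable N I x → ∃ x', M.IsAugmentable N I x' ∧ g x' ≤ g x ∧
        x' ∈ N.closure J := by
  by_cases hex : ∃ x, M.IsAugmentable N I x
  · obtain ⟨x, hx, hmin⟩ := WellFounded.has_min (InvImage.wf g wellFounded_lt)
      {x | M.IsAugmentable N I x} hex
    obtain ⟨z, -, hzE, hzI, J, hJM, hJN, hJM', hJN', hJ⟩ := exists_augment_of_reach (hE ▸ hx.1) hx.1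
      hE.symm.subset hI.indep_left hI.indep_right hx.2.1 hx.2.2
    obtain ⟨K, hJK, hK⟩ := hI.exists_nice_superset hE hJM hJN hzE hzI hJM' hJN'
    refine ⟨K, hK, ?_, hJ.of_subset hJK hK.indep_left hK.indep_right, fun x' hx' ↦
      ⟨x, hx, not_lt.1 (hmin x' hx'), N.closure_subset_closure hJK ?_⟩⟩
    · refine (N.closure_subset_closure (Set.subset_insert x I)).trans ?_
      rw [← hJN']
      exact N.closure_subset_closure hJK
    · rw [hJN']
      exact N.mem_closure_of_mem' (Set.mem_insert _ _) hx.1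
  · exact ⟨I, hI, subset_rfl, fun Z _ _ ↦ ⟨Set.inter_subset_left, fun _ _ _ h ↦ h⟩,
      fun x hx ↦ (hex ⟨x, hx⟩).elim⟩

/-- The limit of a sequence of common independent sets that stabilise on an increasing sequence of
separated sets is a wave, provided that `N` is finitary and everything else gets spanned in `N`. -/
lemma isWave_iUnion [N.Finitary] {J Z : ℕ → Set α} (hJ : ∀ k, N.Indep (J k))
    (hZE : ∀ k, Z k ⊆ N.E) (hJZ : Monotone fun k ↦ J k ∩ Z k)
    (hM : ∀ k, Z k ⊆ M.closure (J k ∩ Z k))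
    (hN : ∀ k, N.closure (J k) \ Z k ⊆ N.closure (J k \ Z k))
    (hcov : ∀ x ∈ N.E \ ⋃ k, Z k, ∃ k, ∀ l ≥ k, x ∈ N.closure (J l)) :
    M.IsWave N ∅ (⋃ k, Z k) := by
  refine ⟨Set.iUnion_subset fun k ↦ by simpa using hZE k, ⋃ k, J k ∩ Z k,
    Set.iUnion_mono fun k ↦ Set.inter_subset_right, Set.iUnion_subset fun k ↦ (hM k).trans
      (M.closure_subset_closure ((Set.subset_iUnion (fun k ↦ J k ∩ Z k) k).trans Set.subset_union_right)), ?_, ?_⟩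
  · exact Set.iUnion_subset fun k ↦ Set.inter_subset_left.trans (hJ k).subset_ground
  intro b hb hcl
  obtain ⟨F, hF, hFfin, -, hbF⟩ := exists_mem_finite_closure_of_mem_closure hcl
  have hev : ∀ x ∈ F, ∀ᶠ k in Filter.atTop, x ∈ N.closure (J k \ {b}) := by
    intro x hx
    obtain ⟨kb, hkb⟩ := Set.mem_iUnion.1 hb
    -- Outside all `Z k`, `x` is eventually spanned by `J l \ Z l`, which avoids `b`. Otherwise `x`
    -- itself stays in `J l`.
    rcases hF hx with hxR | ⟨hxU, hxb⟩
    · obtain ⟨k, hk⟩ := hcov x hxR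
      filter_upwards [Filter.eventually_ge_atTop k, Filter.eventually_ge_atTop kb] with l hl hl'
      refine N.closure_subset_closure ?_ (hN l ⟨hk l hl, fun h ↦ hxR.2 (Set.mem_iUnion.2 ⟨l, h⟩)⟩)
      exact fun a ha ↦ ⟨ha.1, fun h ↦ ha.2 (h ▸ (hJZ hl' hkb).2)⟩
    · obtain ⟨k, hk⟩ := Set.mem_iUnion.1 hxU
      filter_upwards [Filter.eventually_ge_atTop k] with l hl
      exact N.mem_closure_of_mem' ⟨(hJZ hl hk).1, hxb⟩ ((hJ k).subset_ground hk.1)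
  obtain ⟨kb, hkb⟩ := Set.mem_iUnion.1 hb
  obtain ⟨l, hl, hl'⟩ := (((Filter.eventually_all_finite hFfin).2 hev).and
    (Filter.eventually_ge_atTop kb)).exists
  exact (hJ l).notMem_closure_sdiff_of_mem (hJZ hl' hkb).1
    (closure_subset_closure_of_subset_closure hl hbF)

/-- Augment repeatedly by least label. Elements never spanned in `N` eventually stop being
augmentable, so the sets reachable from them freeze and grow to a wave, which consists of `M`-loops.
The remaining elements span `e` and are all spanned in the end. -/
theorem exists_nice_mem_closure [N.Finitary] (hE : M.E = N.E) (hc : N.E.Countable)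
    (h0 : M.IsNice N ∅) (he : e ∈ N.E) : ∃ I, M.IsNice N I ∧ e ∈ N.closure I := by
  obtain ⟨g, hg⟩ := Set.countable_iff_exists_injOn.1 hc
  choose! next hnice hcl hpres haug using
    fun I (hI : M.IsNice N I) ↦ hI.exists_augment_least hE g
  set I : ℕ → Set α := fun n ↦ next^[n] ∅ with hIdef
  have hI : ∀ n, M.IsNice N (I n) := by
    intro n
    induction n with
    | zero => exact h0
    | succ n ih => simp only [hIdef, Function.iterate_succ_apply']; exact hnice _ ih
  have hsucc : ∀ n, I (n + 1) = next (I n) := fun n ↦ Function.iterate_succ_apply' ..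
  have hmono : Monotone fun n ↦ N.closure (I n) :=
    monotone_nat_of_le_succ fun n ↦ by rw [hsucc]; exact hcl _ (hI n)
  -- Once label `k` is least, the next augmentation spans its element for good, as the `N`-closures
  -- increase.
  have hstab : ∀ k, ∃ n, ∀ m ≥ n, ∀ x, M.IsAugmentable N (I m) x → k ≤ g x := by
    intro k
    induction k with
    | zero => exact ⟨0, fun _ _ _ _ ↦ Nat.zero_le _⟩
    | succ k ih =>
      obtain ⟨n, hn⟩ := ih
      by_cases hex : ∃ m ≥ n, ∃ x, M.IsAugmentable N (I m) x ∧ g x = k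
      · obtain ⟨m, hm, x, hx, hxk⟩ := hex
        obtain ⟨x', hx', hle, hx'cl⟩ := haug _ (hI m) x hx
        have hgx' : g x' = k := le_antisymm (hle.trans hxk.le) (hn m hm x' hx')
        refine ⟨m + 1, fun l hl y hy ↦ Nat.lt_of_le_of_ne (hn l (by omega) y hy) fun hky ↦ hy.2.1 ?_⟩
        obtain rfl : y = x' := hg hy.1 hx'.1 (by rw [hgx', ← hky])
        exact hmono hl (by simpa only [hsucc] using hx'cl)
      · push Not at hex
        exact ⟨n, fun m hm x hx ↦ Nat.lt_of_le_of_ne (hn m hm x hx) (hex m hm x hx).symm⟩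
  choose f hf using hstab
  -- The sum makes `φ` monotone and at least `f`; the summand `k` makes it unbounded.
  set φ : ℕ → ℕ := fun k ↦ k + ∑ i ∈ Finset.range (k + 1), f i with hφ
  have hφmono : Monotone φ := monotone_nat_of_le_succ fun k ↦ by
    simp only [hφ, Finset.sum_range_succ _ (k + 1)]; omega
  have hφf : ∀ k, f k ≤ φ k := fun k ↦ by
    simp only [hφ, Finset.sum_range_succ _ k]; omega
  have hφk : ∀ k, k ≤ φ k := fun k ↦ Nat.le_add_right _ _
  set X : ℕ → Set α := fun k ↦ {x | x ∈ N.E ∧ g x < k ∧ ∀ n, x ∉ N.closure (I n)} with hX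
  have hreachM : ∀ k m, φ k ≤ m → M.reach N (I m) (X k) ⊆ M.closure (I m) := by
    intro k m hm
    refine reach_subset_of_forall fun x hx ↦ by_contra fun h ↦ ?_
    exact absurd (hf k m ((hφf k).trans hm) x ⟨hx.1, hx.2.2 m, h⟩) (not_le.2 hx.2.1)
  have hstep : ∀ k m, φ k ≤ m → I m ∩ M.reach N (I m) (X k) ⊆ I (m + 1) ∧
      M.reach N (I m) (X k) ⊆ M.reach N (I (m + 1)) (X k) := by
    intro k m hm
    obtain ⟨h1, h2⟩ := hpres _ (hI m) _ isExchangeClosed_reach (hreachM k m hm)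
    rw [← hsucc] at h1 h2
    refine ⟨h1, ?_⟩
    refine (reach_subset (Z := M.reach N (I m) (X k) ∩ M.reach N (I (m + 1)) (X k))
      (Set.subset_inter subset_reach subset_reach) ?_).trans Set.inter_subset_right
    rintro x ⟨hx, hx'⟩ x' hxx'
    exact ⟨isExchangeClosed_reach x hx x' hxx', isExchangeClosed_reach x hx' x' (h2 x hx x' hxx')⟩
  have hstep' : ∀ k m, φ k ≤ m → I (φ k) ∩ M.reach N (I (φ k)) (X k) ⊆ I m ∧
      M.reach N (I (φ k)) (X k) ⊆ M.reach N (I m) (X k) := by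
    intro k m hm
    induction m, hm using Nat.le_induction with
    | base => exact ⟨Set.inter_subset_left, subset_rfl⟩
    | succ m hm ih =>
      exact ⟨fun x hx ↦ (hstep k m hm).1 ⟨ih.1 hx, ih.2 hx.2⟩, ih.2.trans (hstep k m hm).2⟩
  have hXmono : Monotone X := fun k l hkl x hx ↦ ⟨hx.1, hx.2.1.trans_le hkl, hx.2.2⟩
  set Z : ℕ → Set α := fun k ↦ M.reach N (I (φ k)) (X k) with hZ
  have hZmono : Monotone Z := fun k l hkl ↦
    (hstep' k (φ l) (hφmono hkl)).2.trans (reach_mono (hXmono hkl))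
  have hcov : ∀ x ∈ N.E \ ⋃ k, Z k, ∃ k, ∀ l ≥ k, x ∈ N.closure (I (φ l)) := by
    intro x hx
    by_contra! hcon
    refine hx.2 (Set.mem_iUnion.2 ⟨g x + 1, subset_reach ⟨hx.1, Nat.lt_succ_self _, fun n hn ↦ ?_⟩⟩)
    obtain ⟨l, hl, hl'⟩ := hcon n
    exact hl' (hmono (hl.trans (hφk l)) hn)
  have hclosed : ∀ k, M.IsExchangeClosed N (I (φ k)) (Z k) := fun k ↦ isExchangeClosed_reach
  have hwave : M.IsWave N ∅ (⋃ k, Z k) := by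
    refine isWave_iUnion (J := fun k ↦ I (φ k)) (fun k ↦ (hI _).indep_right)
      (fun k ↦ reach_subset_ground fun x hx ↦ hx.1) ?_ ?_ ?_ hcov
    · exact fun k l hkl x hx ↦ ⟨(hstep' k (φ l) (hφmono hkl)).1 hx, hZmono hkl hx.2⟩
    · exact fun k ↦ (hclosed k).subset_closure_inter (hI _).indep_left
        (hI _).indep_right.subset_ground (hI _).indep_right (hreachM k _ le_rfl)
    · exact fun k ↦ (hclosed k).closure_sdiff_subset (hI _).indep_left (hI _).indep_right
  have hloops := h0.wave_subset _ hwave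
  have he' : e ∈ N.closure (N.E \ ⋃ k, Z k) := by
    refine N.closure_subset_closure ?_ (h0.spanning he)
    rintro x (hx | hx)
    exacts [⟨hx.1, fun h ↦ hx.2 (hloops h)⟩, hx.elim]
  obtain ⟨F, hF, hFfin, -, heF⟩ := exists_mem_finite_closure_of_mem_closure he'
  have hev : ∀ x ∈ F, ∀ᶠ k in Filter.atTop, x ∈ N.closure (I (φ k)) := fun x hx ↦
    Filter.eventually_atTop.2 (hcov x (hF hx))
  obtain ⟨l, hl⟩ := ((Filter.eventually_all_finite hFfin).2 hev).exists
  exact ⟨I (φ l), hI _, closure_subset_closure_of_subset_closure hl heF⟩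

end


/-! ### The intersection theorem for two finitary matroids -/

section

variable {α : Type*} {M N : Matroid α} {X Y Z I J W B : Set α} {e f x x' y z : α} {n k : ℕ}

lemma isWave_contract_iff (hI : I ⊆ N.E) :
    (M ／ I).IsWave (N ／ I) J W ↔ M.IsWave N (I ∪ J) W := by
  simp only [IsWave, contract_ground, Set.sdiff_sdiff]
  refine and_congr_right fun hW ↦ exists_congr fun B ↦ and_congr_right fun hB ↦ and_congr ?_ ?_
  · have h1 : J ∪ B ∪ I = I ∪ J ∪ B := by rw [Set.union_comm, Set.union_assoc]
    rw [contract_closure_eq, Set.subset_sdiff, h1, and_iff_left]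
    exact Set.disjoint_left.2 fun x hx hxI ↦ (hW hx).2 (Or.inl hxI)
  · have h2 : I ∪ N.E \ (I ∪ W) = N.E \ W := by
      ext x
      have h3 := @hI x
      have h4 := @hW x
      simp only [Set.mem_union, Set.mem_sdiff] at *
      tauto
    rw [indepMod_contract_iff, h2]

lemma IsNice.contract (hI : M.IsNice N I) : (M ／ I).IsNice (N ／ I) ∅ where
  indep_left := empty_indep _
  indep_right := empty_indep _
  spanning := by
    rw [contract_closure_eq, contract_closure_eq, contract_ground, Set.union_empty, Set.empty_union]
    refine Set.sdiff_subset_sdiff_left (hI.spanning.trans (N.closure_subset_closure ?_))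
    intro x
    simp only [Set.mem_union, Set.mem_sdiff]
    tauto
  wave_subset W hW := by
    have hW' := (isWave_contract_iff hI.indep_right.subset_ground).1 hW
    rw [Set.union_empty] at hW'
    rw [contract_closure_eq, Set.empty_union]
    exact Set.subset_sdiff.2 ⟨hI.wave_subset W hW',
      Set.disjoint_left.2 fun x hx ↦ (hW'.1 hx).2⟩

lemma IsNice.of_contract (hI : M.IsNice N I) (hJ : (M ／ I).IsNice (N ／ I) J) :
    M.IsNice N (I ∪ J) where
  indep_left := Set.union_comm J I ▸
    (indepMod_iff_contract_indep.2 hJ.indep_left).union_indep hI.indep_left subset_rfl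
  indep_right := Set.union_comm J I ▸
    (indepMod_iff_contract_indep.2 hJ.indep_right).union_indep hI.indep_right subset_rfl
  spanning := by
    intro x hx
    by_cases hxI : x ∈ I
    · exact N.mem_closure_of_mem' (Or.inr (Or.inl hxI)) hx
    have h := hJ.spanning ⟨hx, hxI⟩
    rw [contract_closure_eq, contract_closure_eq, contract_ground] at h
    refine N.closure_subset_closure ?_ h.1
    intro y
    simp only [Set.mem_union, Set.mem_sdiff, Set.union_comm J I]
    tauto
  wave_subset W hW := by
    have h := hJ.wave_subset W ((isWave_contract_iff hI.indep_right.subset_ground).2 hW)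
    rw [contract_closure_eq, Set.union_comm] at h
    exact h.trans Set.sdiff_subset

/-- Contracting a nice set makes `∅` nice, so the one-element result can be iterated along an
enumeration. Finitarity of `M` keeps the union independent. -/
theorem exists_indep_spanning [M.Finitary] [N.Finitary] (hE : M.E = N.E) (hc : N.E.Countable)
    (h0 : M.IsNice N ∅) : ∃ I, M.Indep I ∧ N.E ⊆ N.closure I := by
  obtain hemp | hne := N.E.eq_empty_or_nonempty
  · exact ⟨∅, M.empty_indep, by simp [hemp]⟩
  obtain ⟨f, hf⟩ := hc.exists_eq_range hne
  have hext : ∀ I n, M.IsNice N I → ∃ K, M.IsNice N K ∧ I ⊆ K ∧ f n ∈ N.closure K := by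
    intro I n hI
    have hfE : f n ∈ N.E := hf ▸ ⟨n, rfl⟩
    by_cases hfI : f n ∈ I
    · exact ⟨I, hI, subset_rfl, N.mem_closure_of_mem' hfI⟩
    obtain ⟨J, hJ, hJf⟩ := exists_nice_mem_closure (M := M ／ I) (N := N ／ I) (e := f n)
      (by simp only [contract_ground, hE]) (hc.mono Set.sdiff_subset) hI.contract ⟨hfE, hfI⟩
    rw [contract_closure_eq, Set.union_comm] at hJf
    exact ⟨I ∪ J, hI.of_contract hJ, Set.subset_union_left, hJf.1⟩
  choose! next hnice hsub hmem using hext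
  set I : ℕ → Set α := fun n ↦ Nat.rec ∅ (fun n J ↦ next J n) n with hIdef
  have hI : ∀ n, M.IsNice N (I n) := by
    intro n
    induction n with
    | zero => exact h0
    | succ n ih => exact hnice _ _ ih
  have hmono : Monotone I := monotone_nat_of_le_succ fun n ↦ hsub _ _ (hI n)
  refine ⟨⋃ n, I n, indep_of_forall_finite_subset_indep _ fun F hF hFfin ↦ ?_, ?_⟩
  · have hev : ∀ x ∈ F, ∀ᶠ k in Filter.atTop, x ∈ I k := fun x hx ↦ by
      obtain ⟨k, hk⟩ := Set.mem_iUnion.1 (hF hx)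
      exact Filter.eventually_atTop.2 ⟨k, fun l hl ↦ hmono hl hk⟩
    obtain ⟨l, hl⟩ := ((Filter.eventually_all_finite hFfin).2 hev).exists
    exact (hI l).indep_left.subset hl
  · intro x hx
    obtain ⟨n, rfl⟩ := hf.subset hx
    exact N.closure_subset_closure (Set.subset_iUnion I (n + 1)) (hmem _ _ (hI n))

/-- The conclusion of the Matroid Intersection Conjecture for `M` and `N`, in terms of a pair of
sets that each span one part and are independent in the contraction onto it. -/
def HasIntersection (M N : Matroid α) : Prop :=
  ∃ A D I J : Set α, A ∪ D = N.E ∧ Disjoint A D ∧ I ⊆ A ∧ J ⊆ D ∧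
    A ⊆ M.closure I ∧ N.IndepMod D I ∧ D ⊆ N.closure J ∧ M.IndepMod A J

lemma HasIntersection.symm (hE : M.E = N.E) (h : M.HasIntersection N) : N.HasIntersection M := by
  obtain ⟨A, D, I, J, hAD, hdj, hI, hJ, h1, h2, h3, h4⟩ := h
  exact ⟨D, A, J, I, by rw [Set.union_comm, hAD, hE], hdj.symm, hJ, hI, h3, h4, h1, h2⟩

lemma HasIntersection.exists_common_indep (h : M.HasIntersection N) :
    ∃ I : Set α, M.Indep I ∧ N.Indep I ∧ ∃ A D : Set α, A ∪ D = N.E ∧ Disjoint A D ∧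
      A ⊆ M.closure (I ∩ A) ∧ D ⊆ N.closure (I ∩ D) := by
  obtain ⟨A, D, I, J, hAD, hdj, hI, hJ, h1, h2, h3, h4⟩ := h
  obtain ⟨I', hI'⟩ := M.exists_isBasis' I
  obtain ⟨J', hJ'⟩ := N.exists_isBasis' J
  have hI'A := hI'.subset.trans hI
  have hJ'D := hJ'.subset.trans hJ
  refine ⟨I' ∪ J', ?_, (h2.subset hI'.subset).union_indep hJ'.indep hJ'D, A, D, hAD, hdj, ?_, ?_⟩
  · rw [Set.union_comm]
    exact (h4.subset hJ'.subset).union_indep hI'.indep hI'A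
  · rw [← hI'.closure_eq_closure] at h1
    exact h1.trans (M.closure_subset_closure (Set.subset_inter Set.subset_union_left hI'A))
  · rw [← hJ'.closure_eq_closure] at h3
    exact h3.trans (N.closure_subset_closure (Set.subset_inter Set.subset_union_right hJ'D))

lemma indepMod_of_delete (h : (N ＼ W).IndepMod X B) (hX : Disjoint X W) : N.IndepMod X B := by
  have hB : Disjoint B W := (Set.subset_sdiff.1 h.1).2
  refine ⟨h.1.trans Set.sdiff_subset, fun b hb hcl ↦ h.2 b hb ?_⟩
  rw [delete_closure_eq, (Disjoint.union_left hX (hB.mono_left Set.sdiff_subset)).sdiff_eq_left]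
  exact ⟨hcl, hB.notMem_of_mem_left hb⟩

theorem hasIntersection_of_finitary [M.Finitary] [N.Finitary] (hE : M.E = N.E)
    (hc : N.E.Countable) : M.HasIntersection N := by
  obtain ⟨B, hBW, -, -, hBM, hBN, hcl, -⟩ := exists_maxWave_basis hE M.empty_indep N.empty_indep
  rw [Set.empty_union, Set.empty_union] at hcl
  set W := M.maxWave N ∅ with hW
  have hWE : W ⊆ N.E := hcl ▸ hE ▸ M.closure_subset_ground B
  -- A wave `V` of the remaining pair would enlarge `W` to the wave `V ∪ W`.
  have hwave : ∀ V, (M ／ W).IsWave (N ＼ W) ∅ V → V = ∅ := by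
    rintro V ⟨hVE, B', hB'V, hB'M, hB'N⟩
    rw [Set.sdiff_empty, delete_ground] at hVE
    rw [Set.empty_union, contract_closure_eq] at hB'M
    have hB'N' : N.IndepMod (N.E \ (V ∪ W)) B' := by
      have h := indepMod_of_delete hB'N
        (Set.disjoint_left.2 fun x hx hxW ↦ hx.1.2 hxW)
      rwa [delete_ground, Set.sdiff_sdiff, Set.union_comm] at h
    have hwave : M.IsWave N ∅ (V ∪ W) := by
      refine ⟨by
        rw [Set.sdiff_empty]; exact Set.union_subset (hVE.trans Set.sdiff_subset) hWE,
        B ∪ B', Set.union_subset (hBW.trans Set.subset_union_right)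
          (hB'V.trans Set.subset_union_left), ?_, ?_⟩
      · rw [Set.empty_union]
        have hW' : W ⊆ M.closure (B ∪ B') :=
          hcl.symm.subset.trans (M.closure_subset_closure Set.subset_union_left)
        refine Set.union_subset ((hB'M.trans Set.sdiff_subset).trans
          (closure_subset_closure_of_subset_closure (Set.union_subset ?_ hW'))) hW'
        exact M.subset_closure_of_subset' Set.subset_union_right (hE ▸ hB'N'.1)
      · exact hBN.union hB'N' (Set.sdiff_subset_sdiff_right Set.subset_union_right)
          (hB'V.trans hVE)
    exact Set.eq_empty_of_forall_notMem fun x hx ↦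
      (hVE hx).2 (hwave.subset_maxWave (Or.inl hx))
  -- The set of loops is a wave with empty witness.
  have hloops : (M ／ W).closure ∅ = ∅ := by
    refine hwave _ ⟨?_, ∅, Set.empty_subset _, by simp, Set.empty_subset _, by simp⟩
    rw [Set.sdiff_empty, delete_ground, ← hE]
    exact closure_subset_ground _ _
  have hnice : (M ／ W).IsNice (N ＼ W) ∅ := by
    refine ⟨empty_indep _, empty_indep _, ?_, fun V hV ↦ (hwave V hV).symm ▸ Set.empty_subset _⟩
    rw [hloops, Set.sdiff_empty, Set.union_empty, closure_ground]
  obtain ⟨J, hJM, hJN⟩ := exists_indep_spanning (M := M ／ W) (N := N ＼ W)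
    (by rw [contract_ground, delete_ground, hE]) (hc.mono Set.sdiff_subset) hnice
  rw [← indepMod_iff_contract_indep] at hJM
  have hJE : J ⊆ N.E \ W := hE ▸ (indepMod_iff_contract_indep.1 hJM).subset_ground
  refine ⟨W, N.E \ W, B, J, Set.union_sdiff_cancel hWE, Set.disjoint_sdiff_right, hBW, hJE,
    hcl.symm.subset, hBN, ?_, hJM⟩
  rw [delete_ground, delete_closure_eq] at hJN
  exact hJN.trans (Set.sdiff_subset.trans (N.closure_subset_closure Set.sdiff_subset))

end


/-! ### Reduction to finitary matroids by doubling -/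

section

variable {α β : Type*} {M N F C : Matroid α} {X Y Z I J K A D W B : Set α} {e : α}

lemma disjointSum_closure_eq (h : Disjoint F.E C.E) (X : Set α) :
    (F.disjointSum C h).closure X = F.closure X ∪ C.closure X := by
  set N := F.disjointSum C h with hN
  have hNE : N.E = F.E ∪ C.E := disjointSum_ground_eq
  have key : ∀ X ⊆ F.E ∪ C.E, N.closure X = F.closure X ∪ C.closure X := by
    intro X hX
    obtain ⟨I, hI⟩ := N.exists_isBasis X (hNE ▸ hX)
    obtain ⟨hF, hC, hIX, -⟩ := disjointSum_isBasis_iff.1 hI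
    rw [← F.closure_inter_ground X, ← C.closure_inter_ground X, ← hF.closure_eq_closure,
      ← hC.closure_eq_closure, ← hI.closure_eq_closure]
    ext x
    rw [Set.mem_union, hI.indep.mem_closure_iff', hF.indep.mem_closure_iff',
      hC.indep.mem_closure_iff', hNE, hN, disjointSum_indep_iff]
    have h1 : x ∈ F.E → insert x I ∩ F.E = insert x (I ∩ F.E) ∧ insert x I ∩ C.E = I ∩ C.E :=
      fun hx ↦ ⟨Set.insert_inter_of_mem hx, Set.insert_inter_of_notMem (h.notMem_of_mem_left hx)⟩
    have h2 : x ∈ C.E → insert x I ∩ C.E = insert x (I ∩ C.E) ∧ insert x I ∩ F.E = I ∩ F.E :=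
      fun hx ↦ ⟨Set.insert_inter_of_mem hx, Set.insert_inter_of_notMem (h.notMem_of_mem_right hx)⟩
    have h3 : x ∈ F.E ∪ C.E → insert x I ⊆ F.E ∪ C.E :=
      fun hx ↦ Set.insert_subset hx (hIX.trans hX)
    by_cases hxF : x ∈ F.E
    · have hxC := h.notMem_of_mem_left hxF
      rw [(h1 hxF).1, (h1 hxF).2]
      have := hC.indep
      have := h3 (Or.inl hxF)
      simp only [Set.mem_union, Set.mem_inter_iff]
      tauto
    by_cases hxC : x ∈ C.E
    · rw [(h2 hxC).1, (h2 hxC).2]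
      have := hF.indep
      have := h3 (Or.inr hxC)
      simp only [Set.mem_union, Set.mem_inter_iff]
      tauto
    · simp only [Set.mem_union]
      tauto
  rw [← closure_inter_ground, key _ (hNE ▸ Set.inter_subset_right), hNE,
    ← F.closure_inter_ground (X ∩ _), ← C.closure_inter_ground (X ∩ _), Set.inter_assoc,
    Set.inter_assoc, Set.inter_eq_self_of_subset_right Set.subset_union_left,
    Set.inter_eq_self_of_subset_right Set.subset_union_right, closure_inter_ground,
    closure_inter_ground]

lemma mem_closure_of_inl_mem_closure_sum {M : Matroid α} {N : Matroid β} {I : Set (α ⊕ β)}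
    (hI : (M.sum N).Indep I) {e : α} (he : Sum.inl e ∈ (M.sum N).closure I) :
    e ∈ M.closure (Sum.inl ⁻¹' I) := by
  obtain ⟨hM, hN⟩ := (sum_indep_iff M N).1 hI
  obtain ⟨heE, he⟩ := hI.mem_closure_iff'.1 he
  rw [sum_ground] at heE
  have h1 : Sum.inl ⁻¹' insert (Sum.inl e) I = insert e (Sum.inl ⁻¹' I) := by ext; simp
  have h2 : Sum.inr ⁻¹' insert (Sum.inl e) I = Sum.inr ⁻¹' I := by ext; simp
  refine hM.mem_closure_iff'.2 ⟨by simpa using heE, fun h ↦ he ?_⟩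
  rw [sum_indep_iff, h1, h2]
  exact ⟨h, hN⟩

lemma mem_closure_of_inr_mem_closure_sum {M : Matroid α} {N : Matroid β} {I : Set (α ⊕ β)}
    (hI : (M.sum N).Indep I) {e : β} (he : Sum.inr e ∈ (M.sum N).closure I) :
    e ∈ N.closure (Sum.inr ⁻¹' I) := by
  obtain ⟨hM, hN⟩ := (sum_indep_iff M N).1 hI
  obtain ⟨heE, he⟩ := hI.mem_closure_iff'.1 he
  rw [sum_ground] at heE
  have h1 : Sum.inr ⁻¹' insert (Sum.inr e) I = insert e (Sum.inr ⁻¹' I) := by ext; simp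
  have h2 : Sum.inl ⁻¹' insert (Sum.inr e) I = Sum.inl ⁻¹' I := by ext; simp
  refine hN.mem_closure_iff'.2 ⟨by simpa using heE, fun h ↦ he ?_⟩
  rw [sum_indep_iff, h1, h2]
  exact ⟨hM, h⟩

lemma Finitary.sum {M : Matroid α} {N : Matroid β} (hM : M.Finitary) (hN : N.Finitary) :
    (M.sum N).Finitary := by
  refine ⟨fun I h ↦ (sum_indep_iff M N).2 ⟨indep_of_forall_finite_subset_indep _ fun J hJ hJf ↦ ?_,
    indep_of_forall_finite_subset_indep _ fun J hJ hJf ↦ ?_⟩⟩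
  · have := ((sum_indep_iff M N).1 (h (Sum.inl '' J) (Set.image_subset_iff.2 hJ) (hJf.image _))).1
    rwa [Set.preimage_image_eq _ Sum.inl_injective] at this
  · have := ((sum_indep_iff M N).1 (h (Sum.inr '' J) (Set.image_subset_iff.2 hJ) (hJf.image _))).2
    rwa [Set.preimage_image_eq _ Sum.inr_injective] at this

lemma Finitary.disjointSum (hF : F.Finitary) (hC : C.Finitary) (h : Disjoint F.E C.E) :
    (F.disjointSum C h).Finitary := by
  refine ⟨fun I hI ↦ disjointSum_indep_iff.2 ⟨indep_of_forall_finite_subset_indep _ fun J hJ hJf ↦ ?_,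
    indep_of_forall_finite_subset_indep _ fun J hJ hJf ↦ ?_, fun x hx ↦ ?_⟩⟩
  · have := (disjointSum_indep_iff.1 (hI J (hJ.trans Set.inter_subset_left) hJf)).1
    rwa [Set.inter_eq_self_of_subset_left (hJ.trans Set.inter_subset_right)] at this
  · have := (disjointSum_indep_iff.1 (hI J (hJ.trans Set.inter_subset_left) hJf)).2.1
    rwa [Set.inter_eq_self_of_subset_left (hJ.trans Set.inter_subset_right)] at this
  · exact (disjointSum_indep_iff.1 (hI {x} (by simpa using hx) (Set.finite_singleton x))).2.2 rfl

/-- Extend a basis of `X` together with `e` to a base; the fundamental cocircuit of `e` avoids `X`.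
-/
lemma mem_dual_closure_of_notMem_closure (he : e ∈ M.E) (heX : e ∉ M.closure X) :
    e ∈ M✶.closure ((M.E \ X) \ {e}) := by
  obtain ⟨I, hI⟩ := M.exists_isBasis' X
  rw [← hI.closure_eq_closure] at heX
  obtain ⟨B, hB, hIB⟩ := (hI.indep.insert_of_notMem_closure he heX).exists_isBase_superset
  have heI : e ∉ I := fun h ↦ heX (M.mem_closure_of_mem' h)
  have heB : e ∈ B := hIB (Set.mem_insert _ _)
  have hK := hB.compl_closure_sdiff_singleton_isCocircuit heB
  refine M✶.closure_subset_closure ?_ (IsCircuit.mem_closure_sdiff_singleton_of_mem hK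
    ⟨he, hB.indep.notMem_closure_sdiff_of_mem heB⟩)
  rintro x ⟨⟨hxE, hx⟩, hxe⟩
  refine ⟨⟨hxE, fun hxX ↦ hx ?_⟩, hxe⟩
  have h1 : x ∈ M.closure I := hI.closure_eq_closure ▸ M.mem_closure_of_mem' hxX
  refine M.closure_subset_closure (fun y hy ↦ ?_) h1
  exact ⟨hIB (Or.inr hy), fun h ↦ heI (h ▸ hy)⟩

/-- Otherwise a circuit and a cocircuit would meet in `e` alone. -/
lemma notMem_dual_closure_of_mem_closure (heX : e ∉ X) (heY : e ∉ Y) (hXY : Disjoint X Y)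
    (he : e ∈ M.closure X) : e ∉ M✶.closure Y := by
  intro he'
  obtain ⟨C, hCX, hC, heC⟩ := exists_isCircuit_of_mem_closure he heX
  obtain ⟨K, hKY, hK, heK⟩ := exists_isCircuit_of_mem_closure he' heY
  refine hC.inter_isCocircuit_ne_singleton (e := e) hK (Set.Subset.antisymm ?_ ?_)
  · rintro x ⟨hxC, hxK⟩
    rcases hCX hxC with rfl | hxX
    · rfl
    rcases hKY hxK with rfl | hxY
    · rfl
    exact (hXY.notMem_of_mem_left hxX hxY).elim
  · rintro x rfl
    exact ⟨heC, heK⟩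

/-- From a common independent set for the finitary part `F` together with an independent set `K`
of the dual of `C`, one obtains an intersection of `M` and `F.disjointSum C h`. -/
lemma hasIntersection_disjointSum_of_dual (h : Disjoint F.E C.E)
    (hAD : A ∪ D = F.E ∪ C.E) (hdj : Disjoint A D) (hIM : M.Indep I)
    (hIF : F.Indep (I ∩ F.E)) (hK : C✶.Indep K) (hIK : Disjoint I K)
    (hA : A ⊆ M.closure (I ∩ A)) (hAK : A ∩ C.E ⊆ C✶.closure (K ∩ A))
    (hDF : D ∩ F.E ⊆ F.closure (I ∩ D)) (hDC : D ∩ C.E ⊆ I ∪ K) :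
    M.HasIntersection (F.disjointSum C h) := by
  have hAE : A ⊆ F.E ∪ C.E := hAD ▸ Set.subset_union_left
  have hDE : D ⊆ F.E ∪ C.E := hAD ▸ Set.subset_union_right
  refine ⟨A, D, I ∩ A, I ∩ D, by rw [disjointSum_ground_eq, hAD], hdj, Set.inter_subset_right,
    Set.inter_subset_right, hA, ⟨?_, ?_⟩, ?_, ?_⟩
  · rw [disjointSum_ground_eq]
    exact Set.inter_subset_right.trans hAE
  · rintro b ⟨hbI, hbA⟩ hcl
    rw [disjointSum_closure_eq] at hcl
    rcases hcl with hcl | hcl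
    · have hbF := mem_ground_of_mem_closure hcl
      refine hIF.notMem_closure_sdiff_of_mem ⟨hbI, hbF⟩
        (closure_subset_closure_of_subset_closure ?_ (F.closure_inter_ground _ ▸ hcl))
      rintro x ⟨hx | ⟨hx, hxb⟩, hxF⟩
      · have := hDF ⟨hx, hxF⟩
        rw [← closure_inter_ground] at this
        refine F.closure_subset_closure ?_ this
        exact fun y hy ↦ ⟨⟨hy.1.1, hy.2⟩, fun h ↦ hdj.notMem_of_mem_left hbA (h ▸ hy.1.2)⟩
      · exact F.mem_closure_of_mem' ⟨⟨hx.1, hxF⟩, hxb⟩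
    · refine notMem_dual_closure_of_mem_closure (M := C) ?_ ?_ ?_ hcl
        (hAK ⟨hbA, mem_ground_of_mem_closure hcl⟩)
      · rintro (hb | hb)
        exacts [hdj.notMem_of_mem_left hbA hb, hb.2 rfl]
      · exact fun hb ↦ hIK.notMem_of_mem_left hbI hb.1
      · refine Set.disjoint_left.2 ?_
        rintro x (hx | hx) hx'
        exacts [hdj.notMem_of_mem_left hx'.2 hx, hIK.notMem_of_mem_left hx.1.1 hx'.1]
  · intro e he
    rw [disjointSum_closure_eq]
    rcases hDE he with heF | heC
    · exact Or.inl (hDF ⟨he, heF⟩)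
    -- If `I ∩ D` did not span `e` in `C`, the rest of its complement would span `e` in `C✶`. That
    -- rest lies in `K` on `D` and is spanned by `K ∩ A` on `A`, contradicting independence of `K`.
    refine Or.inr (by_contra fun hcl ↦ ?_)
    have heK : e ∈ K := (hDC ⟨he, heC⟩).resolve_left fun heI ↦
      hcl (C.mem_closure_of_mem' ⟨heI, he⟩)
    refine hK.notMem_closure_sdiff_of_mem heK (closure_subset_closure_of_subset_closure ?_
      (mem_dual_closure_of_notMem_closure heC hcl))
    rintro x ⟨⟨hxC, hx⟩, hxe⟩
    rcases hAD.symm.subset (Or.inr hxC) with hxA | hxD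
    · refine C✶.closure_subset_closure ?_ (hAK ⟨hxA, hxC⟩)
      exact fun y hy ↦ ⟨hy.1, fun h ↦ hdj.notMem_of_mem_left hy.2 (h ▸ he)⟩
    · refine C✶.mem_closure_of_mem' ⟨(hDC ⟨hxD, hxC⟩).resolve_left fun h ↦ hx ⟨h, hxD⟩, hxe⟩ hxC
  · refine ⟨Set.inter_subset_left.trans hIM.subset_ground, fun b hb hcl ↦
      hIM.notMem_closure_sdiff_of_mem hb.1 (closure_subset_closure_of_subset_closure ?_ hcl)⟩
    rintro x (hx | ⟨hx, hxb⟩)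
    · refine M.closure_subset_closure ?_ (hA hx)
      exact fun y hy ↦ ⟨hy.1, fun h ↦ hdj.notMem_of_mem_left hy.2 (h ▸ hb.2)⟩
    · exact M.mem_closure_of_mem ⟨hx.1, hxb⟩ (Set.sdiff_subset.trans hIM.subset_ground)

/-- The matroid on `E ⊆ α ⊕ α` in which the two copies of an element are parallel, and the copies
of the elements of `C` are otherwise unconstrained. -/
def doubleFree (F C : Matroid α) (h : Disjoint F.E C.E) (E : Set (α ⊕ α)) : Matroid (α ⊕ α) :=
  (F.disjointSum (freeOn C.E) (h.mono_right (freeOn_ground (E := C.E)).subset)).comapOn E (Sum.elim id id)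

lemma Finitary.doubleFree (hF : F.Finitary) (h : Disjoint F.E C.E) (E : Set (α ⊕ α)) :
    (doubleFree F C h E).Finitary := by
  have := hF.disjointSum (freeOn_finitary (E := C.E)) (h.mono_right (freeOn_ground (E := C.E)).subset)
  exact comapOn_finitary

lemma doubleFree_closure_eq (h : Disjoint F.E C.E) {E X : Set (α ⊕ α)}
    (hE : E ⊆ Sum.elim id id ⁻¹' (F.E ∪ C.E)) (hX : X ⊆ E) :
    (doubleFree F C h E).closure X = Sum.elim id id ⁻¹' (F.closure (Sum.elim id id '' X) ∪
      Sum.elim id id '' X ∩ C.E) ∩ E := by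
  rw [doubleFree, comapOn, restrict_closure_eq _ hX
    (by rw [comap_ground_eq, disjointSum_ground_eq]; exact hE), comap_closure_eq,
    disjointSum_closure_eq, freeOn_closure_eq]

/-- Doubling the elements of a summand `C` reduces the intersection problem to one where the
second matroid is finitary. -/
theorem hasIntersection_of_sum_doubleFree (h : Disjoint F.E C.E) (hE : M.E = F.E ∪ C.E)
    (hint : (M.sum C✶).HasIntersection (doubleFree F C h (M.sum C✶).E)) :
    M.HasIntersection (F.disjointSum C h) := by
  obtain ⟨T, hTM, hTN, A', D', hAD', hdj', hA', hD'⟩ := hint.exists_common_indep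
  set E := (M.sum C✶).E with hEdef
  set N := doubleFree F C h E with hN
  have hNE : N.E = E := rfl
  -- Passing to the closure puts both copies of an element of `C` on the same side of the partition
  -- without changing `T ∩ D'`.
  set D := N.closure (T ∩ D') with hD
  have hTD : T ∩ D = T ∩ D' := by
    rw [Set.inter_comm, hD]
    exact hTN.closure_inter_eq_self_of_subset Set.inter_subset_left
  have hAA' : E \ D ⊆ A' := fun x hx ↦ (hAD'.symm.subset hx.1).resolve_right fun h ↦ hx.2 (hD' h)
  have hTA : T ∩ A' ⊆ T ∩ (E \ D) := fun x hx ↦ ⟨hx.1, hTN.subset_ground hx.1, fun hxD ↦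
    hdj'.notMem_of_mem_left hx.2 (hTD.subset ⟨hx.1, hxD⟩).2⟩
  have hA : E \ D ⊆ (M.sum C✶).closure (T ∩ (E \ D)) :=
    hAA'.trans (hA'.trans (closure_subset_closure _ hTA))
  have hinl : ∀ e, Sum.inl e ∈ E ↔ e ∈ F.E ∪ C.E := fun e ↦ by simp [hEdef, hE]
  have hinr : ∀ e, Sum.inr e ∈ E ↔ e ∈ C.E := fun e ↦ by simp [hEdef]
  have hEsub : E ⊆ Sum.elim id id ⁻¹' (F.E ∪ C.E) := by
    rintro (e | e) he
    exacts [(hinl e).1 he, Or.inr ((hinr e).1 he)]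
  have hDeq : D = Sum.elim id id ⁻¹' (F.closure (Sum.elim id id '' (T ∩ D)) ∪
      Sum.elim id id '' (T ∩ D) ∩ C.E) ∩ E := by
    rw [hTD, hD]
    exact doubleFree_closure_eq h hEsub (Set.inter_subset_left.trans hTN.subset_ground)
  have hDlr : ∀ e ∈ C.E, (Sum.inl e ∈ D ↔ Sum.inr e ∈ D) := by
    intro e he
    rw [hDeq]
    simp [hinl, hinr, he]
  obtain ⟨hIM, hK⟩ := (sum_indep_iff _ _).1 hTM
  obtain ⟨hTP, hTinj, hTE⟩ := comapOn_indep_iff.1 hTN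
  rw [disjointSum_indep_iff] at hTP
  have hDE : D ⊆ E := N.closure_subset_ground _
  clear_value D N E
  have hKC : ∀ e, Sum.inr e ∈ T → e ∈ C.E := fun e he ↦ (hinr e).1 (hTE he)
  refine hasIntersection_disjointSum_of_dual (I := Sum.inl ⁻¹' T) (K := Sum.inr ⁻¹' T)
    (A := Sum.inl ⁻¹' (E \ D)) (D := Sum.inl ⁻¹' D) h ?_ ?_ hIM ?_ hK ?_ ?_ ?_ ?_ ?_
  · ext e
    rw [← hinl e]
    refine ⟨?_, fun he ↦ (em (Sum.inl e ∈ D)).elim Or.inr fun heD ↦ Or.inl ⟨he, heD⟩⟩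
    rintro (he | he)
    exacts [he.1, hDE he]
  · exact Set.disjoint_left.2 fun e he he' ↦ he.2 he'
  · exact hTP.1.subset fun e he ↦ ⟨⟨Sum.inl e, he.1, rfl⟩, he.2⟩
  · refine Set.disjoint_left.2 fun e he he' ↦ ?_
    exact Sum.inl_ne_inr (hTinj he he' rfl)
  · exact fun e he ↦ mem_closure_of_inl_mem_closure_sum (hTM.subset Set.inter_subset_left) (hA he)
  · rintro e ⟨he, heC⟩
    have her : Sum.inr e ∈ E \ D := ⟨(hinr e).2 heC, fun h ↦ he.2 ((hDlr e heC).2 h)⟩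
    refine C✶.closure_subset_closure ?_
      (mem_closure_of_inr_mem_closure_sum (hTM.subset Set.inter_subset_left) (hA her))
    rintro x ⟨hxT, hxE, hxD⟩
    exact ⟨hxT, (hinl x).2 (Or.inr (hKC x hxT)), fun h ↦ hxD ((hDlr x (hKC x hxT)).1 h)⟩
  · rintro e ⟨he, heF⟩
    have heD : Sum.inl e ∈ D := he
    rw [hDeq] at heD
    rcases heD.1 with heD | heD
    · rw [← closure_inter_ground] at heD
      refine F.closure_subset_closure ?_ heD
      rintro x ⟨⟨(y | y), ⟨hyT, hyD⟩, rfl⟩, hxF⟩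
      · exact ⟨hyT, hyD⟩
      · exact (h.notMem_of_mem_left hxF (hKC y hyT)).elim
    · exact (h.notMem_of_mem_left heF heD.2).elim
  · rintro e ⟨he, heC⟩
    have heD : Sum.inl e ∈ D := he
    rw [hDeq] at heD
    rcases heD.1 with heD | ⟨⟨(y | y), ⟨hyT, hyD⟩, rfl⟩, -⟩
    · exact (h.notMem_of_mem_left (mem_ground_of_mem_closure heD) heC).elim
    · exact Or.inl hyT
    · exact Or.inr hyT

/-- Regrouping makes the cofinitary part of the first matroid a summand again, so that the doubling
can be applied a second time. -/
lemma sum_disjointSum_eq (h : Disjoint F.E C.E) (G : Matroid β)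
    (h' : Disjoint (F.sum G).E (C.map Sum.inl Sum.inl_injective.injOn).E) :
    (F.disjointSum C h).sum G =
      (F.sum G).disjointSum (C.map Sum.inl Sum.inl_injective.injOn) h' := by
  refine ext_indep ?_ fun I hI ↦ ?_
  · rw [sum_ground, disjointSum_ground_eq, disjointSum_ground_eq, sum_ground, map_ground,
      Set.image_union, Set.union_right_comm]
  · rw [sum_indep_iff, disjointSum_indep_iff, disjointSum_indep_iff, sum_indep_iff]
    have hI' : I ⊆ (F.sum G).E ∪ (C.map Sum.inl Sum.inl_injective.injOn).E := by
      rw [sum_ground, disjointSum_ground_eq] at hI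
      rw [sum_ground, map_ground]
      refine hI.trans (by rw [Set.image_union, Set.union_right_comm])
    have hIl : (Sum.inl ⁻¹' I : Set _) ⊆ F.E ∪ C.E := by
      intro x hx
      simpa using hI hx
    have hIr : (Sum.inr ⁻¹' I : Set β) ⊆ G.E := by
      intro x hx
      simpa using hI hx
    have e1 : (Sum.inl ⁻¹' (I ∩ (F.sum G).E) : Set _) = Sum.inl ⁻¹' I ∩ F.E := by
      ext; simp
    have e2 : (Sum.inr ⁻¹' (I ∩ (F.sum G).E) : Set β) = Sum.inr ⁻¹' I := by
      ext x; simpa using fun hx ↦ hIr hx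
    have e3 : I ∩ (C.map Sum.inl Sum.inl_injective.injOn).E =
        (Sum.inl : _ → _ ⊕ β) '' (Sum.inl ⁻¹' I ∩ C.E) := by
      rw [map_ground, Set.image_preimage_inter]
    rw [e1, e2, e3, map_image_indep_iff Set.inter_subset_right]
    tauto

end

end Matroid

/-! ### The main theorem -/

theorem theorem1p2 {α : Type*} (E : Set α) (hE : E.Countable) (M N : Matroid α)
    (hME : M.E = E) (hNE : N.E = E)
    (hM : M.IsFinitarySumCofinitary) (hN : N.IsFinitarySumCofinitary) :
    ∃ I : Set α, M.Indep I ∧ N.Indep I ∧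
      ∃ E_M E_N : Set α, E_M ∪ E_N = E ∧ Disjoint E_M E_N ∧
        E_M ⊆ M.closure (I ∩ E_M) ∧ E_N ⊆ N.closure (I ∩ E_N) := by
  obtain ⟨F₁, C₁, h₁, hF₁, hC₁, rfl⟩ := hM
  obtain ⟨F₂, C₂, h₂, hF₂, hC₂, rfl⟩ := hN
  have hinj : ∀ s : Set α, Set.InjOn (Sum.inl : α → α ⊕ α) s := fun s ↦ Sum.inl_injective.injOn
  have hdj : Disjoint (F₁.sum C₂✶).E (C₁.map Sum.inl (hinj _)).E := by
    rw [Matroid.sum_ground, Matroid.map_ground, Set.disjoint_left]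
    rintro _ (⟨x, hx, rfl⟩ | ⟨x, hx, rfl⟩) ⟨y, hy, hxy⟩
    · exact h₁.notMem_of_mem_left hx (Sum.inl_injective hxy ▸ hy)
    · exact Sum.inl_ne_inr hxy
  suffices hint : (F₁.disjointSum C₁ h₁).HasIntersection (F₂.disjointSum C₂ h₂) by
    rw [← hNE]
    exact hint.exists_common_indep
  refine Matroid.hasIntersection_of_sum_doubleFree h₂
    (by rw [hME, ← hNE, Matroid.disjointSum_ground_eq]) ?_
  have hfin : (F₂.doubleFree C₂ h₂ ((F₁.disjointSum C₁ h₁).sum C₂✶).E).Finitary :=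
    hF₂.doubleFree h₂ _
  have hcount : ((F₁.disjointSum C₁ h₁).sum C₂✶).E.Countable := by
    rw [Matroid.sum_ground, hME]
    refine (hE.image _).union ((hE.mono ?_).image _)
    rw [← hNE, Matroid.disjointSum_ground_eq]
    exact Set.subset_union_right
  have heq := Matroid.sum_disjointSum_eq h₁ C₂✶ hdj
  set N' := F₂.doubleFree C₂ h₂ ((F₁.disjointSum C₁ h₁).sum C₂✶).E with hN'
  have hN'E : N'.E = ((F₁.disjointSum C₁ h₁).sum C₂✶).E := rfl
  -- The second matroid is now finitary; exchanging the roles lets the same reduction remove `C₁`.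
  refine Matroid.HasIntersection.symm hN'E ?_
  rw [heq] at hN'E hcount ⊢
  refine Matroid.hasIntersection_of_sum_doubleFree hdj
    (by rw [hN'E, Matroid.disjointSum_ground_eq]) ?_
  have hC₁' : (C₁.map Sum.inl (hinj _))✶.Finitary := by
    have : C₁✶.Finitary := hC₁
    rw [Matroid.map_dual]
    change (C₁✶.map Sum.inl (hinj _)).Finitary
    infer_instance
  have := hfin.sum hC₁'
  have := (hF₁.sum hC₂).doubleFree hdj (N'.sum (C₁.map Sum.inl (hinj _))✶).E
  refine Matroid.hasIntersection_of_finitary rfl ?_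
  change (N'.sum (C₁.map Sum.inl (hinj _))✶).E.Countable
  rw [Matroid.sum_ground, hN'E]
  refine (hcount.image _).union ((hcount.mono ?_).image _)
  rw [Matroid.disjointSum_ground_eq]
  exact Set.subset_union_right
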